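/- Let $1<p<\infty$, $\alpha\in\mathbb R$ and $I=(-1,1)$. For $V\in C(\overline I)$ consider the Robin eigenvalue problem $$-\big(|u'|^{p-2}u'\big)'+V|u|^{p-2}u=\lambda|u|^{p-2}u\ \text{ on } I,\qquad |u'|^{p-2}u'=\mp\alpha|u|^{p-2}u\ \text{ at } x=\pm1 ,$$ where $u\in W^{1,p}(I)$, $u\neq0$, and the problem is understood weakly: $$\int_I |u'|^{p-2}u'\xi'+(V-\lambda)|u|^{p-2}u\,\xi\,dx+\alpha\Big[(|u|^{p-2}u\,\xi)(1)+(|u|^{p-2}u\,\xi)(-1)\Big]=0\quad\text{for all }\xi\in C^1(\overline I).$$ For $u\in W^{1,p}(I)\setminus\{0\}$ let $$\mathcal R[u]=\frac{\int_I |u'|^p+V|u|^p\,dx+\alpha\big[|u(1)|^p+|u(-1)|^p\big]}{\int_I|u|^p\,dx},$$ and for $i=0,1,2,\dots$ let $$\lambda_i^V=\inf_{A\in\mathcal A_i}\max_{u\in A}\mathcal R[u],$$ where $\mathcal A_i$ is the family of compact sets $A=-A\subset W^{1,p}(I)\setminus\{0\}$ of Krasnoselskii genus at least $i+1$ (the genus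 of $A$ is the least $n\ge0$ for which there is a continuous odd map $A\to\mathbb R^n\setminus\{0\}$, and $\infty$ if there is none). Let $\Gamma_p(V)=\lambda_1^V-\lambda_0^V$ be the fundamental gap. Let $V\in C(\overline I)$ be symmetric, $V(-x)=V(x)$, and single-well, that is, for some $x_0\in I$ it is non-increasing on $(-1,x_0)$ and non-decreasing on $(x_0,1)$. Then $\lambda_0^V$ and $\lambda_1^V$ are eigenvalues of the Robin problem, and $$\Gamma_p(V)\ge\Gamma_p(0),$$ with equality only when $V$ is constant. -/

import Mathlib

open MeasureTheory Set
open scoped ENNReal ContDiff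

noncomputable section

namespace RobinGap

instance factOneLeOfReal (p : ℝ) [h : Fact (1 < p)] : Fact (1 ≤ ENNReal.ofReal p) :=
  ⟨by simpa using ENNReal.ofReal_le_ofReal h.out.le⟩

/-- Lebesgue measure on the open interval `I = (-1, 1)`. -/
abbrev volI : Measure ℝ := volume.restrict (Ioo (-1 : ℝ) 1)

/-- Extension of a function on `[-1, 1]` to the real line, constant outside `[-1, 1]`.
Only its values on `[-1, 1]` are ever used. -/
abbrev ext (u : C(Icc (-1 : ℝ) 1, ℝ)) : ℝ → ℝ :=
  IccExtend (neg_le_self zero_le_one) u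

/-- `g` is the weak (distributional) derivative of `u` on `I`. -/
def IsWeakDeriv (u g : ℝ → ℝ) : Prop :=
  ∀ φ : ℝ → ℝ, ContDiff ℝ ∞ φ → HasCompactSupport φ → tsupport φ ⊆ Ioo (-1 : ℝ) 1 →
    ∫ x, u x * deriv φ x ∂volI = -∫ x, g x * φ x ∂volI

theorem integrable_ext_mul_deriv (u : C(Icc (-1 : ℝ) 1, ℝ)) {φ : ℝ → ℝ}
    (hφ : ContDiff ℝ ∞ φ) : Integrable (fun x => ext u x * deriv φ x) volI := by
  have hc : Continuous (fun x => ext u x * deriv φ x) :=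
    (u.continuous.Icc_extend').mul (hφ.continuous_deriv (by simp))
  exact (hc.continuousOn.integrableOn_compact isCompact_Icc).mono_set Ioo_subset_Icc_self

theorem integrable_lp_mul {q : ℝ≥0∞} [Fact (1 ≤ q)] (g : Lp ℝ q volI) {φ : ℝ → ℝ}
    (hφ : Continuous φ) (hs : HasCompactSupport φ) :
    Integrable (fun x => g x * φ x) volI := by
  have hg : Integrable g volI := (Lp.memLp g).integrable Fact.out
  obtain ⟨C, hC⟩ := hs.exists_bound_of_continuous hφ
  exact hg.mul_bdd (c := C) hφ.aestronglyMeasurable (Filter.Eventually.of_forall hC)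

/-- The Sobolev space `W^{1,p}(I)`. An element is a pair `(u, u')` of the continuous representative
`u` on `[-1, 1]` and its weak derivative `u' ∈ L^p(I)`. The topology is that of the norm
`max (‖u‖_∞) (‖u'‖_p)`, which on the bounded interval `I` is equivalent to the usual norm of
`W^{1,p}(I)`. -/
def W1p (p : ℝ) [Fact (1 < p)] :
    Submodule ℝ (C(Icc (-1 : ℝ) 1, ℝ) × Lp ℝ (ENNReal.ofReal p) volI) where
  carrier := {w | IsWeakDeriv (ext w.1) w.2}
  zero_mem' := by
    intro φ _ _ _
    have h0 : (fun x => (0 : Lp ℝ (ENNReal.ofReal p) volI) x * φ x) =ᵐ[volI] fun _ => 0 := by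
      filter_upwards [Lp.coeFn_zero ℝ (ENNReal.ofReal p) volI] with x hx
      rw [hx, Pi.zero_apply, zero_mul]
    simp only [Prod.fst_zero, Prod.snd_zero]
    rw [integral_congr_ae h0]
    simp [IccExtend]
  add_mem' := by
    intro a b ha hb φ h1 h2 h3
    have e : (fun x => (a + b).2 x * φ x) =ᵐ[volI] fun x => a.2 x * φ x + b.2 x * φ x := by
      filter_upwards [Lp.coeFn_add a.2 b.2] with x hx
      simp only [Prod.snd_add, hx, Pi.add_apply]
      ring
    have e' : (fun x => ext (a + b).1 x * deriv φ x) =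
        fun x => ext a.1 x * deriv φ x + ext b.1 x * deriv φ x := by
      funext x
      simp [IccExtend, add_mul]
    rw [integral_congr_ae e, e',
      integral_add (integrable_ext_mul_deriv _ h1) (integrable_ext_mul_deriv _ h1),
      integral_add (integrable_lp_mul _ h1.continuous h2) (integrable_lp_mul _ h1.continuous h2),
      ha φ h1 h2 h3, hb φ h1 h2 h3]
    ring
  smul_mem' := by
    intro c a ha φ h1 h2 h3
    have e : (fun x => (c • a).2 x * φ x) =ᵐ[volI] fun x => c * (a.2 x * φ x) := by
      filter_upwards [Lp.coeFn_smul c a.2] with x hx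
      simp only [Prod.smul_snd, hx, Pi.smul_apply, smul_eq_mul]
      ring
    have e' : (fun x => ext (c • a).1 x * deriv φ x) =
        fun x => c * (ext a.1 x * deriv φ x) := by
      funext x
      simp [IccExtend, mul_assoc]
    rw [integral_congr_ae e, e', integral_const_mul, integral_const_mul, ha φ h1 h2 h3]
    ring

/-- The (continuous representative of the) Sobolev function `w`, as a function on the line. -/
def fn {p : ℝ} [Fact (1 < p)] (w : W1p p) : ℝ → ℝ := ext w.1.1

/-- The weak derivative of the Sobolev function `w`. -/
def der {p : ℝ} [Fact (1 < p)] (w : W1p p) : ℝ → ℝ := w.1.2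

/-- `u` is a weak solution of `-Δ_p u + V |u|^{p-2} u = lam |u|^{p-2} u` on `I` with the Robin
boundary conditions `|u'|^{p-2} u' = ∓ α |u|^{p-2} u` at `±1`. -/
def IsSolution (p : ℝ) [Fact (1 < p)] (α : ℝ) (V : ℝ → ℝ) (lam : ℝ) (u : W1p p) : Prop :=
  ∀ ξ : ℝ → ℝ, ContDiff ℝ 1 ξ →
    (∫ x, |der u x| ^ (p - 2) * der u x * deriv ξ x
        + (V x - lam) * (|fn u x| ^ (p - 2) * fn u x) * ξ x ∂volI)
      + α * (|fn u 1| ^ (p - 2) * fn u 1 * ξ 1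
        + |fn u (-1)| ^ (p - 2) * fn u (-1) * ξ (-1)) = 0

/-- `lam` is an eigenvalue: the Robin problem has a nonzero weak solution. -/
def IsEigenvalue (p : ℝ) [Fact (1 < p)] (α : ℝ) (V : ℝ → ℝ) (lam : ℝ) : Prop :=
  ∃ u : W1p p, u ≠ 0 ∧ IsSolution p α V lam u

/-- The Rayleigh quotient. -/
def rayleigh (p : ℝ) [Fact (1 < p)] (α : ℝ) (V : ℝ → ℝ) (u : W1p p) : ℝ :=
  ((∫ x, |der u x| ^ p + V x * |fn u x| ^ p ∂volI) + α * (|fn u 1| ^ p + |fn u (-1)| ^ p)) /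
    ∫ x, |fn u x| ^ p ∂volI

/-- There is a continuous odd map from `A` to `ℝⁿ ∖ {0}`. -/
def HasOddMap {E : Type*} [TopologicalSpace E] [Neg E] (A : Set E) (n : ℕ) : Prop :=
  ∃ h : E → Fin n → ℝ, ContinuousOn h A ∧ (∀ x ∈ A, h (-x) = -h x) ∧ ∀ x ∈ A, h x ≠ 0

/-- The Krasnoselskii genus of a symmetric set: the least `n` such that there is a continuous odd
map from `A` to `ℝⁿ ∖ {0}`, and `⊤` if there is none. -/
def genus {E : Type*} [TopologicalSpace E] [Neg E] (A : Set E) : ℕ∞ :=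
  ⨅ (n : ℕ) (_ : HasOddMap A n), (n : ℕ∞)

/-- The admissible sets of the `i`-th minimax problem (`i = 0, 1, 2, …`): the compact symmetric
subsets of `W^{1,p}(I) ∖ {0}` of genus at least `i + 1`. -/
def admissible (p : ℝ) [Fact (1 < p)] (i : ℕ) : Set (Set (W1p p)) :=
  {A | IsCompact A ∧ (∀ u ∈ A, -u ∈ A) ∧ (0 : W1p p) ∉ A ∧ ((i + 1 : ℕ) : ℕ∞) ≤ genus A}

/-- The `i`-th Ljusternik–Schnirelmann eigenvalue `inf_A max_{u ∈ A} R[u]`, the infimum over all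
admissible `A`. -/
def eigenvalue (p : ℝ) [Fact (1 < p)] (α : ℝ) (V : ℝ → ℝ) (i : ℕ) : ℝ :=
  sInf {c | ∃ A ∈ admissible p i, IsGreatest (rayleigh p α V '' A) c}

/-- The fundamental gap `Γ_p(V) = λ₁ - λ₀`. -/
def gap (p : ℝ) [Fact (1 < p)] (α : ℝ) (V : ℝ → ℝ) : ℝ :=
  eigenvalue p α V 1 - eigenvalue p α V 0

/-- `V` is single-well on `I`. -/
def IsSingleWell (V : ℝ → ℝ) : Prop :=
  ∃ x₀ ∈ Ioo (-1 : ℝ) 1, AntitoneOn V (Ioo (-1) x₀) ∧ MonotoneOn V (Ioo x₀ 1)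

/-- `V` is symmetric on `[-1, 1]`. -/
def IsSymmetric (V : ℝ → ℝ) : Prop :=
  ∀ x ∈ Icc (-1 : ℝ) 1, V (-x) = V x

end RobinGap

end

/-!
By symmetry the problem lives on `[0, 1]`: `λ₀` is the first eigenvalue there with a Neumann
condition at `0` (even ground state) and `λ₁` the first one with a Dirichlet condition at `0` (odd
eigenfunction). In both cases the quotient `w = |u'|^{p-2} u' / u^{p-1}` solves the Riccati equation
`w' = V - λ - (p - 1) |w|^q` with `1 / p + 1 / q = 1`. Shooting in `λ` gives a solution with
`w 0 = 0`, and, in the limit `w 0 = n → ∞`, one that blows up at `0`; Picone's inequality shows that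
`λ` is then the minimum of the energy on `[0, 1]`.

These are the minimax values. An admissible set of genus at least two contains a function vanishing
at `0`, because `u ↦ u 0` is continuous and odd; so the largest Rayleigh quotient on it is at least
`λ₁`. Conversely the Rayleigh quotient equals `λ₀` on `{u, -u}`, which has genus one, and `λ₁` on
the loop spanned by the two halves of the odd eigenfunction, which has genus two.

The gap is monotone because comparison of the Riccati equations makes `v / u` nondecreasing, where
`u` and `v` are the Neumann and the Dirichlet eigenfunction. Chebyshev's integral inequality with
weight `|u|^p` then shows that adding a nondecreasing `Q` to the potential raises `λ₁` at least as
much as `λ₀`, as long as the oscillation of `Q` does not exceed the current gap. A general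
nondecreasing difference of potentials is added in sufficiently small steps.
-/

noncomputable section

namespace RobinGap

open Filter Topology NNReal

/-! ### Comparison for scalar differential inequalities -/

section Comparison

variable {D D' : ℝ → ℝ} {a b L : ℝ}

theorem exists_last_nonpos (hab : a ≤ b) (hc : ContinuousOn D (Icc a b)) (ha : D a ≤ 0)
    (hb : 0 < D b) : ∃ s ∈ Ico a b, D s ≤ 0 ∧ ∀ x ∈ Ioc s b, 0 < D x := by
  set S := Icc a b ∩ D ⁻¹' Iic 0
  have hS : IsClosed S := hc.preimage_isClosed_of_isClosed isClosed_Icc isClosed_Iic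
  have hbdd : BddAbove S := ⟨b, fun t ht => ht.1.2⟩
  obtain ⟨⟨has, hsb⟩, hs : D (sSup S) ≤ 0⟩ := hS.csSup_mem ⟨a, left_mem_Icc.2 hab, ha⟩ hbdd
  refine ⟨sSup S, ⟨has, hsb.lt_of_ne fun h => (h ▸ hs).not_gt hb⟩, hs, fun x hx => ?_⟩
  by_contra! hle
  exact (le_csSup hbdd ⟨⟨has.trans hx.1.le, hx.2⟩, hle⟩).not_gt hx.1

theorem antitoneOn_mul_exp_neg_mul (hc : ContinuousOn D (Icc a b))
    (hd : ∀ x ∈ Ioo a b, HasDerivAt D (D' x) x) (h : ∀ x ∈ Ioo a b, D' x ≤ L * D x) :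
    AntitoneOn (fun x => D x * Real.exp (-(L * x))) (Icc a b) := by
  refine antitoneOn_of_hasDerivWithinAt_nonpos (convex_Icc a b) (hc.mul (by fun_prop))
    (f' := fun x => (D' x - L * D x) * Real.exp (-(L * x))) ?_ ?_
  · rw [interior_Icc]
    intro x hx
    have hexp : HasDerivAt (fun x => Real.exp (-(L * x))) (Real.exp (-(L * x)) * -(L * 1)) x :=
      ((hasDerivAt_id x).const_mul L).neg.exp
    exact (((hd x hx).mul hexp).congr_deriv (by ring)).hasDerivWithinAt
  · rw [interior_Icc]
    exact fun x hx => mul_nonpos_of_nonpos_of_nonneg (sub_nonpos.2 (h x hx)) (Real.exp_pos _).le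

theorem nonpos_of_deriv_le_mul (hc : ContinuousOn D (Icc a b))
    (hd : ∀ x ∈ Ioo a b, HasDerivAt D (D' x) x)
    (h : ∀ x ∈ Ioo a b, 0 < D x → D' x ≤ L * D x) (ha : D a ≤ 0) :
    ∀ x ∈ Icc a b, D x ≤ 0 := by
  intro z hz
  by_contra! hpos
  obtain ⟨s, hs, hDs, hDpos⟩ :=
    exists_last_nonpos hz.1 (hc.mono (Icc_subset_Icc_right hz.2)) ha hpos
  have hsub : Ioo s z ⊆ Ioo a b := Ioo_subset_Ioo hs.1 hz.2
  have hanti := antitoneOn_mul_exp_neg_mul (hc.mono (Icc_subset_Icc hs.1 hz.2))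
    (fun x hx => hd x (hsub hx))
    (fun x hx => h x (hsub hx) (hDpos x (Ioo_subset_Ioc_self hx)))
    (left_mem_Icc.2 hs.2.le) (right_mem_Icc.2 hs.2.le) hs.2.le
  have hDs' := mul_nonpos_of_nonpos_of_nonneg hDs (Real.exp_pos (-(L * s))).le
  exact (hanti.trans hDs').not_gt (mul_pos hpos (Real.exp_pos _))

theorem nonpos_of_neg_mul_le_deriv (hc : ContinuousOn D (Icc a b))
    (hd : ∀ x ∈ Ioo a b, HasDerivAt D (D' x) x)
    (h : ∀ x ∈ Ioo a b, 0 < D x → -(L * D x) ≤ D' x) (hb : D b ≤ 0) :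
    ∀ x ∈ Icc a b, D x ≤ 0 := by
  have hneg : ∀ x ∈ Ioo (-b) (-a), -x ∈ Ioo a b := fun x hx =>
    ⟨by linarith [hx.2], by linarith [hx.1]⟩
  have hreflected := nonpos_of_deriv_le_mul (D := fun x => D (-x)) (D' := fun x => -D' (-x))
    (a := -b) (b := -a) (L := L)
    (hc.comp continuousOn_neg fun x hx => ⟨by linarith [hx.2], by linarith [hx.1]⟩)
    (fun x hx => ((hd _ (hneg x hx)).comp x (hasDerivAt_neg x)).congr_deriv (by ring))
    (fun x hx hpos => by linarith [h _ (hneg x hx) hpos]) (by simpa using hb)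
  intro x hx
  simpa using hreflected (-x) ⟨neg_le_neg hx.2, neg_le_neg hx.1⟩

theorem abs_le_of_deriv_le {w w' : ℝ → ℝ} {C : ℝ} (hC : 0 ≤ C) (hc : ContinuousOn w (Icc a b))
    (hd : ∀ x ∈ Ioo a b, HasDerivAt w (w' x) x) (h : ∀ x ∈ Ioo a b, w' x ≤ C) :
    ∀ x ∈ Icc a b, |w x| ≤ |w a| + |w b| + C * (b - a) := by
  intro x hx
  have hab : a ≤ b := hx.1.trans hx.2
  have hslope : ∀ s ∈ Icc a b, ∀ t ∈ Icc a b, s ≤ t → w t - w s ≤ C * (t - s) := by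
    refine (convex_Icc a b).image_sub_le_mul_sub_of_deriv_le hc ?_ ?_ <;> rw [interior_Icc]
    · exact fun y hy => (hd y hy).differentiableAt.differentiableWithinAt
    · exact fun y hy => (hd y hy).deriv.trans_le (h y hy)
  have hleft := hslope a (left_mem_Icc.2 hab) x hx hx.1
  have hright := hslope x hx b (right_mem_Icc.2 hab) hx.2
  have hCx : C * (x - a) ≤ C * (b - a) := by gcongr; exact hx.2
  have hCb : C * (b - x) ≤ C * (b - a) := by gcongr; exact hx.1
  rw [abs_le]
  constructor <;> linarith [le_abs_self (w a), neg_abs_le (w b), abs_nonneg (w a), abs_nonneg (w b)]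

end Comparison

/-! ### Shooting -/

section Shooting

variable {F : ℝ → ℝ → ℝ} {K : ℝ≥0} {a b : ℝ}

theorem exists_hasDerivWithinAt_sub_const (hab : a ≤ b) (hF : ∀ t ∈ Icc a b, LipschitzWith K (F t))
    (hcont : ∀ x, ContinuousOn (F · x) (Icc a b)) {M : ℝ} (hM : ∀ t ∈ Icc a b, ∀ x, |F t x| ≤ M)
    (w₀ lam : ℝ) : ∃ w : ℝ → ℝ, w a = w₀ ∧
      ∀ t ∈ Icc a b, HasDerivWithinAt w (F t (w t) - lam) (Icc a b) t := by
  have hM0 : 0 ≤ M := (abs_nonneg _).trans (hM a (left_mem_Icc.2 hab) 0)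
  let N : ℝ≥0 := ⟨M + |lam|, by positivity⟩
  have hPL : IsPicardLindelof (fun t x => F t x - lam) (⟨a, left_mem_Icc.2 hab⟩ : Icc a b) w₀
      (N * (b - a).toNNReal) 0 N K :=
    { lipschitzOnWith := fun t ht => by
        simpa using ((hF t ht).sub (LipschitzWith.const lam)).lipschitzOnWith
      continuousOn := fun x _ => (hcont x).sub continuousOn_const
      norm_le := fun t ht x _ => (abs_sub _ _).trans (add_le_add_left (hM t ht x) _)
      mul_max_le := by simp [hab] }
  exact hPL.exists_eq_forall_mem_Icc_hasDerivWithinAt₀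

theorem continuous_apply_right_of_hasDerivWithinAt (hab : a < b)
    (hF : ∀ t ∈ Icc a b, LipschitzWith K (F t)) {w : ℝ → ℝ → ℝ} {w₀ : ℝ} (ha : ∀ lam, w lam a = w₀)
    (hw : ∀ lam, ∀ t ∈ Icc a b, HasDerivWithinAt (w lam) (F t (w lam t) - lam) (Icc a b) t) :
    Continuous fun lam => w lam b := by
  have hright : ∀ lam, ∀ t ∈ Ico a b,
      HasDerivWithinAt (w lam) (F t (w lam t) - lam) (Ici t) t := fun lam t ht =>
    (hw lam t (Ico_subset_Icc_self ht)).mono_of_mem_nhdsWithin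
      (mem_of_superset (Icc_mem_nhdsGE ht.2) (Icc_subset_Icc_left ht.1))
  have hcont : ∀ lam, ContinuousOn (w lam) (Icc a b) := fun lam t ht =>
    (hw lam t ht).continuousWithinAt
  have hdist : ∀ lam mu, dist (w mu b) (w lam b) ≤ gronwallBound 0 K (|mu - lam| + 0) (b - a) := by
    intro lam mu
    refine dist_le_of_approx_trajectories_ODE_of_mem (v := fun t x => F t x - lam)
      (s := fun _ => univ) (fun t ht => ?_) (hcont mu) (hright mu)
      (fun t _ => (Real.dist_eq _ _).trans_le (abs_sub_comm mu lam ▸ by ring_nf; rfl))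
      (fun _ _ => mem_univ _) (hcont lam) (hright lam) (fun t _ => ?_) (fun _ _ => mem_univ _)
      (by simp [ha]) b (right_mem_Icc.2 hab.le)
    · exact lipschitzOnWith_univ.2 <| by
        simpa using (hF t (Ico_subset_Icc_self ht)).sub (LipschitzWith.const lam)
    · simp
  refine continuous_iff_continuousAt.2 fun lam => tendsto_iff_dist_tendsto_zero.2 ?_
  have hbound : Continuous fun mu : ℝ => gronwallBound 0 K (|mu - lam| + 0) (b - a) :=
    (gronwallBound_continuous_ε 0 K (b - a)).comp (by fun_prop)
  refine squeeze_zero (fun _ => dist_nonneg) (hdist lam) ?_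
  simpa [gronwallBound_ε0_δ0] using hbound.tendsto lam

theorem exists_shooting (hab : a < b) (hF : ∀ t ∈ Icc a b, LipschitzWith K (F t))
    (hcont : ∀ x, ContinuousOn (F · x) (Icc a b)) {M : ℝ} (hM : ∀ t ∈ Icc a b, ∀ x, |F t x| ≤ M)
    (w₀ w₁ : ℝ) : ∃ (lam : ℝ) (w : ℝ → ℝ), w a = w₀ ∧ w b = w₁ ∧ ContinuousOn w (Icc a b) ∧
      ∀ t ∈ Ioo a b, HasDerivAt w (F t (w t) - lam) t := by
  choose w ha hw using exists_hasDerivWithinAt_sub_const hab.le hF hcont hM w₀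
  have hwc : ∀ lam, ContinuousOn (w lam) (Icc a b) := fun lam t ht =>
    (hw lam t ht).continuousWithinAt
  have hwd : ∀ lam, ∀ t ∈ Ioo a b, HasDerivAt (w lam) (F t (w lam t) - lam) t :=
    fun lam t ht => (hw lam t (Ioo_subset_Icc_self ht)).hasDerivAt (Icc_mem_nhds ht.1 ht.2)
  have hmean : ∀ lam, ∃ t ∈ Icc a b, (F t (w lam t) - lam) * (b - a) = w lam b - w₀ := by
    intro lam
    obtain ⟨t, ht, h⟩ := exists_hasDerivAt_eq_slope (w lam) _ hab (hwc lam) (hwd lam)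
    exact ⟨t, Ioo_subset_Icc_self ht, by
      rw [h, ha, div_mul_cancel₀ _ (sub_pos.2 hab).ne']⟩
  set s := (w₁ - w₀) / (b - a)
  have hs' : s * (b - a) = w₁ - w₀ := div_mul_cancel₀ _ (sub_pos.2 hab).ne'
  have hlow : w₁ ≤ w (-M - s) b := by
    obtain ⟨t, ht, h⟩ := hmean (-M - s)
    have : s * (b - a) ≤ (F t (w (-M - s) t) - (-M - s)) * (b - a) :=
      mul_le_mul_of_nonneg_right (by linarith [(abs_le.1 (hM t ht (w (-M - s) t))).1])
        (sub_pos.2 hab).le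
    linarith
  have hhigh : w (M - s) b ≤ w₁ := by
    obtain ⟨t, ht, h⟩ := hmean (M - s)
    have : (F t (w (M - s) t) - (M - s)) * (b - a) ≤ s * (b - a) :=
      mul_le_mul_of_nonneg_right (by linarith [(abs_le.1 (hM t ht (w (M - s) t))).2])
        (sub_pos.2 hab).le
    linarith
  obtain ⟨lam, hlam⟩ := mem_range_of_exists_le_of_exists_ge
    (continuous_apply_right_of_hasDerivWithinAt hab hF ha hw) ⟨_, hhigh⟩ ⟨_, hlow⟩
  exact ⟨lam, w lam, ha lam, hlam, hwc lam, hwd lam⟩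

theorem sub_lt_of_apply_lt_line {w : ℝ → ℝ} {lam s m : ℝ}
    (hab : a ≤ b) (hF : ∀ t ∈ Icc a b, LipschitzWith K (F t)) (hwc : ContinuousOn w (Icc a b))
    (hw : ∀ t ∈ Ioo a b, HasDerivAt w (F t (w t) - lam) t)
    (hm : ∀ t ∈ Icc a b, m ≤ F t (w a + s * (t - a))) (hb : w b < w a + s * (b - a)) :
    m - s < lam := by
  by_contra! hlam
  have hline := nonpos_of_deriv_le_mul (D := fun x => w a + s * (x - a) - w x)
    (D' := fun x => s - (F x (w x) - lam)) (a := a) (b := b) (L := K)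
    ((by fun_prop : Continuous fun x => w a + s * (x - a)).continuousOn.sub hwc) ?_ ?_ (by simp)
    b (right_mem_Icc.2 hab)
  · linarith
  · intro x hx
    exact ((((hasDerivAt_id x).sub_const a).const_mul s).const_add (w a)).sub (hw x hx)
      |>.congr_deriv (by ring)
  · intro x hx hpos
    have hx' := Ioo_subset_Icc_self hx
    have hlip := (hF x hx').dist_le_mul (w a + s * (x - a)) (w x)
    rw [Real.dist_eq, Real.dist_eq, abs_of_pos (a := _ - w x) hpos] at hlip
    linarith [le_abs_self (F x (w a + s * (x - a)) - F x (w x)), hm x hx']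

end Shooting

/-! ### The Riccati equation -/

section Riccati

variable {p q a b : ℝ}

/-- The function `w` solves the Riccati equation `w' = c - (p - 1) |w|^q` on `(a, b)`. With `q`
conjugate to `p` and `c = V - lam`, this is the equation of the quotient
`|u'|^{p-2} u' / (|u|^{p-2} u)` for a zero-free solution `u` of
`-(|u'|^{p-2} u')' + V |u|^{p-2} u = lam |u|^{p-2} u`. -/
def Riccati (p q : ℝ) (c w : ℝ → ℝ) (a b : ℝ) : Prop :=
  ∀ x ∈ Ioo a b, HasDerivAt w (c x - (p - 1) * |w x| ^ q) x

theorem Riccati.mono {c w : ℝ → ℝ} {a' b' : ℝ} (h : Riccati p q c w a b) (ha : a ≤ a')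
    (hb : b' ≤ b) : Riccati p q c w a' b' :=
  fun x hx => h x (Ioo_subset_Ioo ha hb hx)

theorem exists_lipschitzOnWith_abs_rpow (hq : 1 < q) (H : ℝ) :
    ∃ K : ℝ≥0, LipschitzOnWith K (fun x : ℝ => |x| ^ q) (Icc (-H) H) :=
  (contDiff_norm_rpow (E := ℝ) hq).contDiffOn.exists_lipschitzOnWith one_ne_zero
    (convex_Icc (-H) H) isCompact_Icc

theorem exists_lipschitzWith_min_abs_rpow (hq : 1 < q) {H : ℝ} (hH : 0 ≤ H) :
    ∃ K : ℝ≥0, LipschitzWith K (fun x : ℝ => min |x| H ^ q) := by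
  obtain ⟨K, hK⟩ := exists_lipschitzOnWith_abs_rpow hq H
  have hmin : LipschitzWith 1 fun x : ℝ => min |x| H := by
    simpa using lipschitzWith_one_norm.min (LipschitzWith.const (α := ℝ) H)
  refine ⟨K * 1, ?_⟩
  have hmem : MapsTo (fun x : ℝ => min |x| H) univ (Icc (-H) H) := fun x _ =>
    ⟨(neg_nonpos.2 hH).trans (le_min (abs_nonneg x) hH), min_le_right _ _⟩
  have hcomp := lipschitzOnWith_univ.1 (hK.comp hmin.lipschitzOnWith hmem)
  have heq : (fun x : ℝ => |x| ^ q) ∘ (fun x => min |x| H) = fun x => min |x| H ^ q :=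
    funext fun x => by simp [abs_of_nonneg (le_min (abs_nonneg x) hH)]
  rwa [heq] at hcomp

theorem continuousOn_abs_rpow {f : ℝ → ℝ} {s : Set ℝ} {r : ℝ} (hr : 0 ≤ r)
    (hf : ContinuousOn f s) : ContinuousOn (fun x => |f x| ^ r) s :=
  hf.abs.rpow_const fun _ _ => Or.inr hr

theorem Riccati.le_of_right (hp : 1 < p) (hq : 1 < q) {c₁ c₂ w₁ w₂ : ℝ → ℝ}
    (h₁ : Riccati p q c₁ w₁ a b) (h₂ : Riccati p q c₂ w₂ a b)
    (hw₁ : ContinuousOn w₁ (Icc a b)) (hw₂ : ContinuousOn w₂ (Icc a b))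
    (hc : ∀ x ∈ Ioo a b, c₁ x ≤ c₂ x) (hb : w₂ b ≤ w₁ b) : ∀ x ∈ Icc a b, w₂ x ≤ w₁ x := by
  obtain ⟨H₁, hH₁⟩ := isCompact_Icc.exists_bound_of_continuousOn hw₁
  obtain ⟨H₂, hH₂⟩ := isCompact_Icc.exists_bound_of_continuousOn hw₂
  obtain ⟨K, hK⟩ := exists_lipschitzOnWith_abs_rpow hq (max H₁ H₂)
  have hdiff := nonpos_of_neg_mul_le_deriv (L := (p - 1) * K) (hw₂.sub hw₁)
    (fun x hx => (h₂ x hx).sub (h₁ x hx)) (fun x hx hpos => ?_) (sub_nonpos.2 hb)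
  · exact fun x hx => sub_nonpos.1 (hdiff x hx)
  · have hx' := Ioo_subset_Icc_self hx
    have hlip := hK.dist_le_mul (w₂ x) (abs_le.1 ((hH₂ x hx').trans (le_max_right _ _)))
      (w₁ x) (abs_le.1 ((hH₁ x hx').trans (le_max_left _ _)))
    rw [Real.dist_eq, Real.dist_eq, abs_of_pos (a := w₂ x - w₁ x) hpos] at hlip
    have := mul_le_mul_of_nonneg_left ((le_abs_self _).trans hlip) (sub_pos.2 hp).le
    simp only [Pi.sub_apply]
    linarith [hc x hx]

theorem exists_riccati (hp : 1 < p) (hq : 1 < q) (hab : a < b) {V : ℝ → ℝ}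
    (hV : ContinuousOn V (Icc a b)) (w₀ w₁ : ℝ) :
    ∃ (lam : ℝ) (w : ℝ → ℝ), w a = w₀ ∧ w b = w₁ ∧ ContinuousOn w (Icc a b) ∧
      Riccati p q (fun x => V x - lam) w a b := by
  have hp1 : 0 ≤ p - 1 := (sub_pos.2 hp).le
  have hba : 0 < b - a := sub_pos.2 hab
  obtain ⟨B, hB⟩ := isCompact_Icc.exists_bound_of_continuousOn hV
  simp only [Real.norm_eq_abs, abs_le] at hB
  set s := (w₁ - w₀ + 1) / (b - a)
  have hs : s * (b - a) = w₁ - w₀ + 1 := div_mul_cancel₀ _ hba.ne'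
  obtain ⟨m, hm⟩ := isCompact_Icc.exists_bound_of_continuousOn
    (by fun_prop : Continuous fun x => w₀ + s * (x - a)).continuousOn (s := Icc a b)
  -- The bounds on `lam` and on `w'` do not involve the truncation level `H`.
  set C := max 0 (B + (B + (p - 1) * m ^ q + s))
  set H := |w₀| + |w₁| + C * (b - a)
  have hC : 0 ≤ C := le_max_left _ _
  have hH : 0 ≤ H := by positivity
  set G : ℝ → ℝ := fun x => (p - 1) * min |x| H ^ q with hG
  have hmin : ∀ x, 0 ≤ min |x| H := fun x => le_min (abs_nonneg x) hH
  have hG0 : ∀ x, 0 ≤ G x := fun x => mul_nonneg hp1 (Real.rpow_nonneg (hmin x) _)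
  have hG_le : ∀ {x r}, min |x| H ≤ r → G x ≤ (p - 1) * r ^ q := fun h =>
    mul_le_mul_of_nonneg_left (Real.rpow_le_rpow (hmin _) h (by linarith)) hp1
  obtain ⟨K, hK⟩ := exists_lipschitzWith_min_abs_rpow hq hH
  have hF : ∀ t ∈ Icc a b, LipschitzWith (0 + ‖p - 1‖₊ * K) (fun x => V t - G x) := fun t _ =>
    (LipschitzWith.const (V t)).sub ((lipschitzWith_smul (p - 1)).comp hK)
  obtain ⟨lam, w, rfl, rfl, hwc, hw⟩ := exists_shooting hab hF
    (fun x => hV.sub continuousOn_const) (M := B + (p - 1) * H ^ q)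
    (fun t ht x => abs_le.2 ⟨by linarith [(hB t ht).1, hG_le (min_le_right |x| H)],
      by linarith [(hB t ht).2, hG0 x, (hG0 x).trans (hG_le (min_le_right |x| H))]⟩) w₀ w₁
  have hlam : -B - (p - 1) * m ^ q - s < lam :=
    sub_lt_of_apply_lt_line hab.le hF hwc hw (fun t ht => by
      linarith [(hB t ht).1, hG_le ((min_le_left _ H).trans (hm t ht))]) (by linarith)
  have hbound : ∀ x ∈ Icc a b, |w x| ≤ H := abs_le_of_deriv_le hC hwc hw fun x hx => by
    linarith [(hB x (Ioo_subset_Icc_self hx)).2, hG0 (w x),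
      le_max_right 0 (B + (B + (p - 1) * m ^ q + s))]
  refine ⟨lam, w, rfl, rfl, hwc, fun x hx => (hw x hx).congr_deriv ?_⟩
  simp only [hG, min_eq_left (hbound x (Ioo_subset_Icc_self hx))]
  ring

end Riccati

/-! ### Sobolev functions on an interval -/

section SobolevOn

variable {f g : ℝ → ℝ} {a b p : ℝ}

theorem absolutelyContinuousOnInterval_of_dist_le {K : ℝ}
    (hf : AbsolutelyContinuousOnInterval f a b)
    (h : ∀ x ∈ uIcc a b, ∀ y ∈ uIcc a b, dist (g x) (g y) ≤ K * dist (f x) (f y)) :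
    AbsolutelyContinuousOnInterval g a b := by
  unfold AbsolutelyContinuousOnInterval at hf ⊢
  refine squeeze_zero' (Eventually.of_forall fun _ => Finset.sum_nonneg fun i _ => dist_nonneg) ?_
    (by simpa using hf.const_mul K)
  rw [eventually_inf_principal]
  filter_upwards with E hE
  rw [Finset.mul_sum]
  exact Finset.sum_le_sum fun i hi => h _ (hE.1 i hi).1 _ (hE.1 i hi).2

theorem absolutelyContinuousOnInterval_abs_rpow (hp : 1 < p)
    (hf : AbsolutelyContinuousOnInterval f a b) :
    AbsolutelyContinuousOnInterval (fun x => |f x| ^ p) a b := by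
  obtain ⟨C, hC⟩ := hf.exists_bound
  obtain ⟨K, hK⟩ := exists_lipschitzOnWith_abs_rpow hp C
  exact absolutelyContinuousOnInterval_of_dist_le hf fun x hx y hy =>
    hK.dist_le_mul _ (abs_le.1 (hC x hx)) _ (abs_le.1 (hC y hy))

theorem absolutelyContinuousOnInterval_of_eq_integral (hab : a ≤ b)
    (hg : IntervalIntegrable g volume a b) (hf : ∀ x ∈ Icc a b, f x = f a + ∫ t in a..x, g t) :
    AbsolutelyContinuousOnInterval f a b := by
  refine absolutelyContinuousOnInterval_of_dist_le (K := 1)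
    (hg.absolutelyContinuousOnInterval_intervalIntegral (c := a) left_mem_uIcc) ?_
  rw [uIcc_of_le hab]
  intro x hx y hy
  rw [hf x hx, hf y hy, dist_add_left, one_mul]

theorem continuousOn_of_eq_integral (hab : a ≤ b) (hg : IntervalIntegrable g volume a b)
    (hf : ∀ x ∈ Icc a b, f x = f a + ∫ t in a..x, g t) : ContinuousOn f (Icc a b) := by
  simpa only [uIcc_of_le hab] using
    (absolutelyContinuousOnInterval_of_eq_integral hab hg hf).continuousOn

/-- `f` belongs to `W^{1,p}(a, b)`, with weak derivative `g`. The function `f` is the absolutely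
continuous representative, and nothing is said about it outside `[a, b]`. -/
structure SobolevOn (p a b : ℝ) (f g : ℝ → ℝ) : Prop where
  intervalIntegrable : IntervalIntegrable g volume a b
  intervalIntegrable_rpow : IntervalIntegrable (fun x => |g x| ^ p) volume a b
  eq_integral : ∀ x ∈ Icc a b, f x = f a + ∫ t in a..x, g t

namespace SobolevOn

theorem id (p a b : ℝ) : SobolevOn p a b (fun x => x) fun _ => 1 :=
  ⟨by simp, by simp, by simp⟩

theorem continuousOn (hab : a ≤ b) (h : SobolevOn p a b f g) : ContinuousOn f (Icc a b) :=
  continuousOn_of_eq_integral hab h.intervalIntegrable h.eq_integral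

theorem ae_hasDerivAt (h : SobolevOn p a b f g) :
    ∀ᵐ x ∂volume.restrict (Ioo a b), HasDerivAt f (g x) x := by
  rw [ae_restrict_iff' measurableSet_Ioo]
  filter_upwards [h.intervalIntegrable.ae_hasDerivAt_integral] with x hderiv hx
  refine ((hderiv (Icc_subset_uIcc (Ioo_subset_Icc_self hx)) a left_mem_uIcc).const_add
    (f a)).congr_of_eventuallyEq ?_
  filter_upwards [Icc_mem_nhds hx.1 hx.2] using h.eq_integral

theorem intervalIntegrable_mul_rpow (hab : a ≤ b) (hp : 0 ≤ p) {V : ℝ → ℝ}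
    (hV : ContinuousOn V (Icc a b)) (h : SobolevOn p a b f g) :
    IntervalIntegrable (fun x => V x * |f x| ^ p) volume a b :=
  (hV.mul (continuousOn_abs_rpow hp (h.continuousOn hab))).intervalIntegrable_of_Icc hab

end SobolevOn

end SobolevOn

/-! ### Picone's inequality -/

section Picone

variable {p q a b : ℝ}

/-- The odd power `x ↦ |x|^{q-2} x`, in terms of which the `p`-Laplace equation is written. -/
def signedPow (q x : ℝ) : ℝ := |x| ^ (q - 2) * x

theorem abs_signedPow (hq : 1 < q) (x : ℝ) : |signedPow q x| = |x| ^ (q - 1) := by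
  rcases eq_or_ne x 0 with rfl | h
  · simp [signedPow, Real.zero_rpow (sub_pos.2 hq).ne']
  · rw [signedPow, abs_mul, abs_of_nonneg (by positivity), ← Real.rpow_add_one (abs_ne_zero.2 h)]
    ring_nf

theorem mul_signedPow_mul_le (hpq : p.HolderConjugate q) (w f g : ℝ) :
    p * (w * signedPow p f * g) ≤ |g| ^ p + (p - 1) * |w| ^ q * |f| ^ p := by
  have hpow : |w * signedPow p f| ^ q = |w| ^ q * |f| ^ p := by
    rw [abs_mul, abs_signedPow hpq.lt, Real.mul_rpow (abs_nonneg _) (by positivity),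
      ← Real.rpow_mul (abs_nonneg _), hpq.sub_one_mul_conj]
  have hyoung := mul_le_mul_of_nonneg_left
    (Real.young_inequality g (w * signedPow p f) hpq) hpq.nonneg
  rw [hpow, mul_add, mul_div_cancel₀ _ hpq.ne_zero, mul_div_assoc', mul_div_right_comm,
    hpq.div_conj_eq_sub_one] at hyoung
  linarith

namespace Riccati

variable {c w : ℝ → ℝ}

theorem continuousOn_deriv (hq : 0 ≤ q) (hc : ContinuousOn c (Icc a b))
    (hw : ContinuousOn w (Icc a b)) :
    ContinuousOn (fun x => c x - (p - 1) * |w x| ^ q) (Icc a b) :=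
  hc.sub (continuousOn_const.mul (continuousOn_abs_rpow hq hw))

theorem eq_integral (hq : 0 ≤ q) (hc : ContinuousOn c (Icc a b)) (hw : ContinuousOn w (Icc a b))
    (h : Riccati p q c w a b) :
    ∀ x ∈ Icc a b, w x = w a + ∫ t in a..x, (c t - (p - 1) * |w t| ^ q) := by
  intro x hx
  have hsub : Icc a x ⊆ Icc a b := Icc_subset_Icc_right hx.2
  rw [intervalIntegral.integral_eq_sub_of_hasDerivAt_of_le hx.1 (hw.mono hsub)
    (h.mono le_rfl hx.2)
    (((continuousOn_deriv hq hc hw).mono hsub).intervalIntegrable_of_Icc hx.1)]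
  ring

theorem picone (hpq : p.HolderConjugate q) (hab : a ≤ b) {f g : ℝ → ℝ}
    (hc : ContinuousOn c (Icc a b)) (hw : ContinuousOn w (Icc a b)) (h : Riccati p q c w a b)
    (hf : SobolevOn p a b f g) :
    w b * |f b| ^ p - w a * |f a| ^ p ≤ ∫ x in a..b, |g x| ^ p + c x * |f x| ^ p := by
  have hAC : AbsolutelyContinuousOnInterval (fun x => w x * |f x| ^ p) a b :=
    (absolutelyContinuousOnInterval_of_eq_integral hab
      ((continuousOn_deriv hpq.symm.nonneg hc hw).intervalIntegrable_of_Icc hab)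
      (h.eq_integral hpq.symm.nonneg hc hw)).fun_mul
    (absolutelyContinuousOnInterval_abs_rpow hpq.lt
      (absolutelyContinuousOnInterval_of_eq_integral hab hf.intervalIntegrable hf.eq_integral))
  rw [← hAC.integral_deriv_eq_sub]
  refine intervalIntegral.integral_mono_ae_restrict hab hAC.intervalIntegrable_deriv
    (hf.intervalIntegrable_rpow.add (hf.intervalIntegrable_mul_rpow hab hpq.nonneg hc)) ?_
  rw [← Measure.restrict_congr_set Ioo_ae_eq_Icc]
  filter_upwards [hf.ae_hasDerivAt, ae_restrict_mem measurableSet_Ioo] with x hfx hx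
  have hderiv : deriv (fun x => w x * |f x| ^ p) x =
      (c x - (p - 1) * |w x| ^ q) * |f x| ^ p + w x * (p * |f x| ^ (p - 2) * f x * g x) :=
    ((h x hx).mul ((hasDerivAt_abs_rpow (f x) hpq.lt).comp x hfx)).deriv
  have hyoung := mul_signedPow_mul_le hpq (w x) (f x) (g x)
  rw [signedPow] at hyoung
  rw [hderiv]
  linarith

end Riccati

end Picone

/-! ### The two Riccati problems on `[0, 1]` -/

/-- The numerator of the Rayleigh quotient on the interval `[0, 1]`, with a Robin condition
at `1` only: half the numerator on `[-1, 1]` of an even or odd function. -/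
def halfEnergy (p α : ℝ) (V f g : ℝ → ℝ) : ℝ :=
  (∫ x in (0 : ℝ)..1, |g x| ^ p + V x * |f x| ^ p) + α * |f 1| ^ p

/-- The denominator of the Rayleigh quotient on the interval `[0, 1]`. -/
def halfMass (p : ℝ) (f : ℝ → ℝ) : ℝ := ∫ x in (0 : ℝ)..1, |f x| ^ p

section HalfProblems

variable {p q α lam : ℝ} {V w f g : ℝ → ℝ}

theorem SobolevOn.halfEnergy_add {Q : ℝ → ℝ} (hp : 0 ≤ p) (hV : ContinuousOn V (Icc 0 1))
    (hQ : ContinuousOn Q (Icc 0 1)) (h : SobolevOn p 0 1 f g) :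
    halfEnergy p α (fun x => V x + Q x) f g =
      halfEnergy p α V f g + ∫ x in (0 : ℝ)..1, Q x * |f x| ^ p := by
  have hsplit : ∀ x, |g x| ^ p + (V x + Q x) * |f x| ^ p =
      (|g x| ^ p + V x * |f x| ^ p) + Q x * |f x| ^ p := fun x => by ring
  simp only [halfEnergy, hsplit]
  rw [intervalIntegral.integral_add (h.intervalIntegrable_rpow.add
    (h.intervalIntegrable_mul_rpow zero_le_one hp hV))
    (h.intervalIntegrable_mul_rpow zero_le_one hp hQ)]
  ring

theorem SobolevOn.halfEnergy_sub_const (hp : 0 ≤ p) (hV : ContinuousOn V (Icc 0 1))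
    (h : SobolevOn p 0 1 f g) (lam : ℝ) :
    halfEnergy p α (fun x => V x - lam) f g = halfEnergy p α V f g - lam * halfMass p f := by
  simpa [← sub_eq_add_neg, halfMass] using
    h.halfEnergy_add (α := α) hp hV (continuousOn_const (c := -lam))

theorem Riccati.mul_halfMass_le (hpq : p.HolderConjugate q) (hV : ContinuousOn V (Icc 0 1))
    (hwc : ContinuousOn w (Icc 0 1)) (hw : Riccati p q (fun x => V x - lam) w 0 1)
    (h1 : w 1 = -α) (hf : SobolevOn p 0 1 f g) (h0 : w 0 * |f 0| ^ p = 0) :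
    lam * halfMass p f ≤ halfEnergy p α V f g := by
  have hpicone := hw.picone hpq zero_le_one (hV.sub (g := fun _ => lam) continuousOn_const) hwc hf
  have hsub := hf.halfEnergy_sub_const (α := α) hpq.nonneg hV lam
  simp only [halfEnergy] at hsub ⊢
  simp only [Pi.sub_apply] at hpicone
  rw [h1, h0] at hpicone
  linarith

/-- The Riccati problem for the first eigenvalue with a Neumann condition at `0` and a Robin
condition at `1`. -/
structure NeumannRiccati (p q α : ℝ) (V : ℝ → ℝ) (lam : ℝ) (w : ℝ → ℝ) : Prop where
  riccati : Riccati p q (fun x => V x - lam) w 0 1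
  continuousOn : ContinuousOn w (Icc 0 1)
  apply_zero : w 0 = 0
  apply_one : w 1 = -α

/-- The Riccati problem for the first eigenvalue with a Dirichlet condition at `0` and a Robin
condition at `1`. As `w` blows up at `0`, Picone's inequality does not apply to it on `[0, 1]`;
the resulting lower bound for the energy is inherited from regular approximations and is recorded
as a field. -/
structure DirichletRiccati (p q α : ℝ) (V : ℝ → ℝ) (lam : ℝ) (w : ℝ → ℝ) : Prop where
  riccati : Riccati p q (fun x => V x - lam) w 0 1
  continuousOn : ContinuousOn w (Ioc 0 1)
  tendsto : Tendsto w (𝓝[>] 0) atTop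
  apply_one : w 1 = -α
  mul_halfMass_le : ∀ f g, SobolevOn p 0 1 f g → f 0 = 0 →
    lam * halfMass p f ≤ halfEnergy p α V f g

theorem exists_neumannRiccati (hpq : p.HolderConjugate q) (α : ℝ)
    (hV : ContinuousOn V (Icc 0 1)) : ∃ lam w, NeumannRiccati p q α V lam w := by
  obtain ⟨lam, w, h0, h1, hc, h⟩ := exists_riccati hpq.lt hpq.symm.lt one_pos hV 0 (-α)
  exact ⟨lam, w, h, hc, h0, h1⟩

theorem NeumannRiccati.mul_halfMass_le (hpq : p.HolderConjugate q) (hV : ContinuousOn V (Icc 0 1))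
    (h : NeumannRiccati p q α V lam w) (hf : SobolevOn p 0 1 f g) :
    lam * halfMass p f ≤ halfEnergy p α V f g :=
  h.riccati.mul_halfMass_le hpq hV h.continuousOn h.apply_one hf (by simp [h.apply_zero])

end HalfProblems

/-! ### The Dirichlet problem as a limit -/

section Limit

variable {p q a b : ℝ}

theorem tendsto_integral_of_bounded {f : ℕ → ℝ → ℝ} {F : ℝ → ℝ} {B : ℝ} (hab : a ≤ b)
    (hf : ∀ n, ContinuousOn (f n) (Icc a b)) (hB : ∀ n, ∀ x ∈ Icc a b, |f n x| ≤ B)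
    (hlim : ∀ x ∈ Icc a b, Tendsto (fun n => f n x) atTop (𝓝 (F x))) :
    IntervalIntegrable F volume a b ∧
      Tendsto (fun n => ∫ x in a..b, f n x) atTop (𝓝 (∫ x in a..b, F x)) := by
  have hsub : uIoc a b ⊆ Icc a b := uIoc_of_le hab ▸ Ioc_subset_Icc_self
  have hmeas : ∀ n, AEStronglyMeasurable (f n) (volume.restrict (uIoc a b)) := fun n =>
    ((hf n).mono hsub).aestronglyMeasurable measurableSet_uIoc
  have hmem : ∀ᵐ x ∂volume.restrict (uIoc a b), x ∈ uIoc a b := ae_restrict_mem measurableSet_uIoc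
  constructor
  · refine (intervalIntegrable_const (c := B)).mono_fun' (aestronglyMeasurable_of_tendsto_ae atTop
      hmeas (hmem.mono fun x hx => hlim x (hsub hx))) (hmem.mono fun x hx => ?_)
    exact le_of_tendsto (hlim x (hsub hx)).norm (Eventually.of_forall fun n => hB n x (hsub hx))
  · exact intervalIntegral.tendsto_integral_filter_of_dominated_convergence (fun _ => B)
      (Eventually.of_forall hmeas)
      (Eventually.of_forall fun n => Eventually.of_forall fun x hx => hB n x (hsub hx)) (by simp)
      (Eventually.of_forall fun x hx => hlim x (hsub hx))

theorem hasDerivAt_of_eq_integral {f g : ℝ → ℝ} {x : ℝ} (hg : ContinuousOn g (Icc a b))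
    (hf : ∀ x ∈ Icc a b, f x = f a + ∫ t in a..x, g t) (hx : x ∈ Ioo a b) :
    HasDerivAt f (g x) x := by
  have hnhds : Icc a b ∈ 𝓝 x := Icc_mem_nhds hx.1 hx.2
  have hint : IntervalIntegrable g volume a x :=
    (hg.mono (Icc_subset_Icc_right hx.2.le)).intervalIntegrable_of_Icc hx.1.le
  refine ((intervalIntegral.integral_hasDerivAt_right hint
    ((hg.mono Ioo_subset_Icc_self).stronglyMeasurableAtFilter isOpen_Ioo x hx)
    (hg.continuousAt hnhds)).const_add (f a)).congr_of_eventuallyEq ?_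
  filter_upwards [hnhds] using hf

theorem Riccati.of_tendsto (hp : 1 ≤ p) (hq : 0 ≤ q) (hab : a ≤ b) {c : ℝ → ℝ} {C H : ℝ}
    {cn wn : ℕ → ℝ → ℝ} {w : ℝ → ℝ} (hc : ContinuousOn c (Icc a b))
    (hcn : ∀ n, ContinuousOn (cn n) (Icc a b)) (hwn : ∀ n, ContinuousOn (wn n) (Icc a b))
    (h : ∀ n, Riccati p q (cn n) (wn n) a b)
    (hC : ∀ n, ∀ x ∈ Icc a b, |cn n x| ≤ C) (hH : ∀ n, ∀ x ∈ Icc a b, |wn n x| ≤ H)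
    (hcl : ∀ x ∈ Icc a b, Tendsto (fun n => cn n x) atTop (𝓝 (c x)))
    (hwl : ∀ x ∈ Icc a b, Tendsto (fun n => wn n x) atTop (𝓝 (w x))) :
    ContinuousOn w (Icc a b) ∧ Riccati p q c w a b := by
  have hp1 : 0 ≤ p - 1 := sub_nonneg.2 hp
  have hbound : ∀ n, ∀ x ∈ Icc a b,
      |cn n x - (p - 1) * |wn n x| ^ q| ≤ C + (p - 1) * H ^ q := by
    intro n x hx
    refine (abs_sub _ _).trans (add_le_add (hC n x hx) ?_)
    rw [abs_of_nonneg (mul_nonneg hp1 (by positivity))]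
    gcongr
    exact hH n x hx
  have hconv : ∀ x ∈ Icc a b, IntervalIntegrable (fun t => c t - (p - 1) * |w t| ^ q) volume a x ∧
      Tendsto (fun n => ∫ t in a..x, (cn n t - (p - 1) * |wn n t| ^ q)) atTop
        (𝓝 (∫ t in a..x, (c t - (p - 1) * |w t| ^ q))) := fun x hx => by
    have hsub : Icc a x ⊆ Icc a b := Icc_subset_Icc_right hx.2
    exact tendsto_integral_of_bounded hx.1
      (fun n => (Riccati.continuousOn_deriv hq (hcn n) (hwn n)).mono hsub)
      (fun n t ht => hbound n t (hsub ht)) (fun t ht => (hcl t (hsub ht)).sub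
        (((hwl t (hsub ht)).abs.rpow_const (Or.inr hq)).const_mul _))
  have heq : ∀ x ∈ Icc a b, w x = w a + ∫ t in a..x, (c t - (p - 1) * |w t| ^ q) := fun x hx =>
    tendsto_nhds_unique ((hwl x hx).congr fun n => (h n).eq_integral hq (hcn n) (hwn n) x hx)
      ((hwl a (left_mem_Icc.2 hab)).add (hconv x hx).2)
  have hwc : ContinuousOn w (Icc a b) :=
    continuousOn_of_eq_integral hab (hconv b (right_mem_Icc.2 hab)).1 heq
  exact ⟨hwc, fun x hx =>
    hasDerivAt_of_eq_integral (Riccati.continuousOn_deriv hq hc hwc) heq hx⟩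

theorem continuousOn_Ioc_of_forall_Icc {f : ℝ → ℝ} (h : ∀ s ∈ Ioo a b, ContinuousOn f (Icc s b)) :
    ContinuousOn f (Ioc a b) := by
  intro x hx
  obtain ⟨s, has, hsx⟩ := exists_between hx.1
  refine (h s ⟨has, hsx.trans_le hx.2⟩ x ⟨hsx.le, hx.2⟩).mono_of_mem_nhdsWithin ?_
  filter_upwards [self_mem_nhdsWithin, mem_nhdsWithin_of_mem_nhds (Ioi_mem_nhds hsx)] with y hy hsy
  exact ⟨(mem_Ioi.1 hsy).le, hy.2⟩

theorem tendsto_nhdsGT_of_continuousOn_Icc {f : ℝ → ℝ} (hab : a < b)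
    (hf : ContinuousOn f (Icc a b)) : Tendsto f (𝓝[>] a) (𝓝 (f a)) := by
  simpa only [nhdsWithin_Ioc_eq_nhdsGT hab] using
    ((hf a (left_mem_Icc.2 hab.le)).mono Ioc_subset_Icc_self).tendsto

end Limit

section Dirichlet

variable {p q α : ℝ} {V : ℝ → ℝ}

theorem Riccati.lam_le_of_apply_left_lt {a b l₁ l₂ : ℝ} {w₁ w₂ : ℝ → ℝ} (hp : 1 < p) (hq : 1 < q)
    (hab : a ≤ b) (h₁ : Riccati p q (fun x => V x - l₁) w₁ a b)
    (h₂ : Riccati p q (fun x => V x - l₂) w₂ a b) (hw₁ : ContinuousOn w₁ (Icc a b))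
    (hw₂ : ContinuousOn w₂ (Icc a b)) (ha : w₁ a < w₂ a) (hb : w₁ b = w₂ b) : l₁ ≤ l₂ := by
  by_contra! hlt
  exact (h₁.le_of_right hp hq h₂ hw₁ hw₂ (fun x _ => by linarith) hb.ge a
    (left_mem_Icc.2 hab)).not_gt ha

/-- Solutions `w n` of the Riccati problems with data `n` at `0` and `-α` at `1`, and the
parameters `l n` for which they exist. They approximate the solution of the Dirichlet problem. -/
structure DirichletApprox (p q α : ℝ) (V : ℝ → ℝ) (l : ℕ → ℝ) (w : ℕ → ℝ → ℝ) : Prop where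
  riccati : ∀ n, Riccati p q (fun x => V x - l n) (w n) 0 1
  continuousOn : ∀ n, ContinuousOn (w n) (Icc 0 1)
  apply_zero : ∀ n, w n 0 = n
  apply_one : ∀ n, w n 1 = -α

theorem exists_dirichletApprox (hpq : p.HolderConjugate q) (α : ℝ) (hV : ContinuousOn V (Icc 0 1)) :
    ∃ l w, DirichletApprox p q α V l w := by
  choose l w h0 h1 hc h using fun n : ℕ =>
    exists_riccati hpq.lt hpq.symm.lt one_pos hV (n : ℝ) (-α)
  exact ⟨l, w, h, hc, h0, h1⟩

namespace DirichletApprox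

variable {l : ℕ → ℝ} {w : ℕ → ℝ → ℝ}

theorem monotone_lam (hpq : p.HolderConjugate q) (h : DirichletApprox p q α V l w) :
    Monotone l :=
  monotone_nat_of_le_succ fun n =>
    (h.riccati n).lam_le_of_apply_left_lt hpq.lt hpq.symm.lt zero_le_one (h.riccati (n + 1))
      (h.continuousOn n) (h.continuousOn (n + 1)) (by simp [h.apply_zero]) (by simp [h.apply_one])

theorem monotone_apply (hpq : p.HolderConjugate q) (h : DirichletApprox p q α V l w) {x : ℝ}
    (hx : x ∈ Icc (0 : ℝ) 1) : Monotone fun n => w n x := fun m n hmn =>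
  (h.riccati n).le_of_right hpq.lt hpq.symm.lt (h.riccati m) (h.continuousOn n) (h.continuousOn m)
    (fun x _ => by linarith [h.monotone_lam hpq hmn]) (by simp [h.apply_one]) x hx

theorem mul_halfMass_le (hpq : p.HolderConjugate q) (hV : ContinuousOn V (Icc 0 1))
    (h : DirichletApprox p q α V l w) {f g : ℝ → ℝ} (hf : SobolevOn p 0 1 f g) (hf0 : f 0 = 0)
    (n : ℕ) : l n * halfMass p f ≤ halfEnergy p α V f g :=
  (h.riccati n).mul_halfMass_le hpq hV (h.continuousOn n) (h.apply_one n) hf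
    (by simp [hf0, Real.zero_rpow hpq.ne_zero])

theorem bddAbove_lam (hpq : p.HolderConjugate q) (hV : ContinuousOn V (Icc 0 1))
    (h : DirichletApprox p q α V l w) : BddAbove (range l) := by
  have hmass : 0 < halfMass p fun x => x :=
    intervalIntegral.intervalIntegral_pos_of_pos_on
      ((continuousOn_abs_rpow hpq.nonneg continuousOn_id).intervalIntegrable_of_Icc zero_le_one)
      (fun x hx => Real.rpow_pos_of_pos (abs_pos.2 hx.1.ne') p) one_pos
  refine ⟨halfEnergy p α V (fun x => x) (fun _ => 1) / halfMass p fun x => x, ?_⟩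
  rintro _ ⟨n, rfl⟩
  exact (le_div_iff₀ hmass).2 (h.mul_halfMass_le hpq hV (SobolevOn.id p 0 1) rfl n)

theorem exists_mul_rpow_le (hpq : p.HolderConjugate q) (hV : ContinuousOn V (Icc 0 1))
    (h : DirichletApprox p q α V l w) :
    ∃ M, 0 ≤ M ∧ ∀ n, ∀ x ∈ Icc (0 : ℝ) 1, w n x * x ^ p ≤ M := by
  obtain ⟨B, hB⟩ := isCompact_Icc.exists_bound_of_continuousOn hV
  have hB0 : 0 ≤ B := (norm_nonneg _).trans (hB 0 (by simp))
  refine ⟨1 + (B + |l 0|), by positivity, fun n x hx => ?_⟩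
  have hsub : Icc 0 x ⊆ Icc (0 : ℝ) 1 := Icc_subset_Icc_right hx.2
  have hVl : ContinuousOn (fun x => V x - l n) (Icc 0 x) := (hV.mono hsub).sub continuousOn_const
  have hpicone := ((h.riccati n).mono le_rfl hx.2).picone hpq hx.1 hVl
    ((h.continuousOn n).mono hsub) (SobolevOn.id p 0 x)
  have hint := (SobolevOn.id p 0 x).intervalIntegrable_rpow.add
    ((SobolevOn.id p 0 x).intervalIntegrable_mul_rpow hx.1 hpq.nonneg hVl)
  have hmono := intervalIntegral.integral_mono_on hx.1 hint
    (intervalIntegrable_const (c := 1 + (B + |l 0|))) fun t ht => by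
      have hVB : V t - l n ≤ B + |l 0| := by
        linarith [(abs_le.1 (hB t (hsub ht))).2, h.monotone_lam hpq (Nat.zero_le n),
          neg_abs_le (l 0)]
      have hpow : |t| ^ p ≤ 1 :=
        Real.rpow_le_one (abs_nonneg _) (abs_le.2 ⟨by linarith [ht.1], (hsub ht).2⟩) hpq.nonneg
      have : (V t - l n) * |t| ^ p ≤ (B + |l 0|) * 1 := by gcongr
      simpa using this
  simp only [Real.zero_rpow hpq.ne_zero, abs_zero, mul_zero, sub_zero, abs_of_nonneg hx.1]
    at hpicone
  refine hpicone.trans (hmono.trans ?_)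
  rw [intervalIntegral.integral_const, sub_zero, smul_eq_mul]
  exact mul_le_of_le_one_left (by positivity) hx.2

theorem exists_abs_le (hpq : p.HolderConjugate q) (hV : ContinuousOn V (Icc 0 1))
    (h : DirichletApprox p q α V l w) {s : ℝ} (hs : 0 < s) :
    ∃ H, ∀ n, ∀ x ∈ Icc s 1, |w n x| ≤ H := by
  obtain ⟨A, hA⟩ := isCompact_Icc.exists_bound_of_continuousOn (h.continuousOn 0)
  obtain ⟨M, hM0, hM⟩ := h.exists_mul_rpow_le hpq hV
  refine ⟨max A (M / s ^ p), fun n x hx => ?_⟩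
  have hx' : x ∈ Icc (0 : ℝ) 1 := ⟨hs.le.trans hx.1, hx.2⟩
  have hupper : w n x ≤ M / s ^ p :=
    calc w n x ≤ M / x ^ p :=
          (le_div_iff₀ (Real.rpow_pos_of_pos (hs.trans_le hx.1) p)).2 (hM n x hx')
      _ ≤ M / s ^ p := by gcongr; exacts [hpq.nonneg, hx.1]
  exact (abs_le_max_abs_abs (h.monotone_apply hpq hx' (Nat.zero_le n)) hupper).trans
    (max_le_max (hA x hx') (abs_of_nonneg (by positivity)).le)

end DirichletApprox

theorem exists_dirichletRiccati (hpq : p.HolderConjugate q) (α : ℝ)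
    (hV : ContinuousOn V (Icc 0 1)) : ∃ lam w, DirichletRiccati p q α V lam w := by
  obtain ⟨l, w, h⟩ := exists_dirichletApprox hpq α hV
  have hl : Tendsto l atTop (𝓝 (⨆ n, l n)) :=
    tendsto_atTop_ciSup (h.monotone_lam hpq) (h.bddAbove_lam hpq hV)
  set W : ℝ → ℝ := fun x => ⨆ n, w n x with hW
  have hbdd : ∀ x ∈ Ioc (0 : ℝ) 1, BddAbove (range fun n => w n x) := fun x hx => by
    obtain ⟨H, hH⟩ := h.exists_abs_le hpq hV hx.1
    exact ⟨H, by rintro _ ⟨n, rfl⟩; exact (abs_le.1 (hH n x ⟨le_rfl, hx.2⟩)).2⟩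
  have hlim : ∀ x ∈ Ioc (0 : ℝ) 1, Tendsto (fun n => w n x) atTop (𝓝 (W x)) := fun x hx =>
    tendsto_atTop_ciSup (h.monotone_apply hpq (Ioc_subset_Icc_self hx)) (hbdd x hx)
  obtain ⟨B, hB⟩ := isCompact_Icc.exists_bound_of_continuousOn hV
  obtain ⟨Λ, hΛ⟩ := hl.abs.bddAbove_range
  have hregular : ∀ s ∈ Ioo (0 : ℝ) 1,
      ContinuousOn W (Icc s 1) ∧ Riccati p q (fun x => V x - ⨆ n, l n) W s 1 := by
    intro s hs
    have hsub : Icc s 1 ⊆ Ioc (0 : ℝ) 1 := fun x hx => ⟨hs.1.trans_le hx.1, hx.2⟩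
    have hV' := hV.mono (hsub.trans Ioc_subset_Icc_self)
    obtain ⟨H, hH⟩ := h.exists_abs_le hpq hV hs.1
    exact Riccati.of_tendsto hpq.lt.le hpq.symm.nonneg hs.2.le (C := B + Λ)
      (hV'.sub continuousOn_const)
      (fun n => hV'.sub continuousOn_const)
      (fun n => (h.continuousOn n).mono (hsub.trans Ioc_subset_Icc_self))
      (fun n => (h.riccati n).mono hs.1.le le_rfl)
      (fun n x hx => (abs_sub _ _).trans
        (add_le_add (hB x (Ioc_subset_Icc_self (hsub hx))) (hΛ ⟨n, rfl⟩)))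
      hH (fun x _ => tendsto_const_nhds.sub hl) (fun x hx => hlim x (hsub hx))
  refine ⟨⨆ n, l n, W, fun x hx => ?_,
    continuousOn_Ioc_of_forall_Icc fun s hs => (hregular s hs).1, tendsto_atTop.2 fun r => ?_,
    by simp [hW, h.apply_one], fun f g hf hf0 => ?_⟩
  · obtain ⟨s, hs0, hsx⟩ := exists_between hx.1
    exact (hregular s ⟨hs0, hsx.trans hx.2⟩).2 x ⟨hsx, hx.2⟩
  · obtain ⟨n, hn⟩ := exists_nat_gt r
    have hright : Tendsto (w n) (𝓝[>] 0) (𝓝 n) :=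
      h.apply_zero n ▸ tendsto_nhdsGT_of_continuousOn_Icc one_pos (h.continuousOn n)
    filter_upwards [hright.eventually (lt_mem_nhds hn), Ioc_mem_nhdsGT one_pos] with x hrx hx
    exact hrx.le.trans (le_ciSup (hbdd x hx) n)
  · exact le_of_tendsto (hl.mul_const _)
      (Eventually.of_forall (h.mul_halfMass_le hpq hV hf hf0))

end Dirichlet

/-! ### Signed powers -/

section SignedPow

variable {p q x y : ℝ}

theorem continuous_signedPow (hq : 1 < q) : Continuous (signedPow q) := by
  have hnorm : ContDiff ℝ 1 fun x : ℝ => ‖x‖ ^ q := contDiff_norm_rpow hq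
  have hderiv : signedPow q = fun x => q⁻¹ * deriv (fun x : ℝ => ‖x‖ ^ q) x := by
    funext x
    rw [(hasDerivAt_norm_rpow x hq).deriv, mul_assoc, inv_mul_cancel_left₀ (by linarith), signedPow,
      Real.norm_eq_abs]
  rw [hderiv]
  exact (hnorm.continuous_deriv le_rfl).const_mul _

theorem signedPow_neg : signedPow q (-x) = -signedPow q x := by
  simp [signedPow]

theorem signedPow_mul : signedPow q (x * y) = signedPow q x * signedPow q y := by
  simp only [signedPow, abs_mul, Real.mul_rpow (abs_nonneg x) (abs_nonneg y)]
  ring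

theorem signedPow_mul_of_abs_eq_one (hx : |x| = 1) : signedPow q (x * y) = x * signedPow q y := by
  rw [signedPow_mul, signedPow, hx, Real.one_rpow, one_mul]

theorem signedPow_of_pos (hx : 0 < x) : signedPow q x = x ^ (q - 1) := by
  rw [signedPow, abs_of_pos hx, ← Real.rpow_add_one hx.ne']
  ring_nf

theorem signedPow_of_nonneg (hq : 1 < q) (hx : 0 ≤ x) : signedPow q x = x ^ (q - 1) := by
  rcases hx.eq_or_lt with rfl | hx
  · simp [signedPow, Real.zero_rpow (sub_pos.2 hq).ne']
  · exact signedPow_of_pos hx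

theorem monotone_signedPow (hq : 1 < q) : Monotone (signedPow q) := by
  refine monotone_of_odd_of_monotoneOn_nonneg (fun _ => signedPow_neg) fun x hx y hy hxy => ?_
  rw [signedPow_of_nonneg hq hx, signedPow_of_nonneg hq hy]
  exact Real.rpow_le_rpow hx hxy (sub_pos.2 hq).le

theorem signedPow_mul_self (hq : q ≠ 0) (x : ℝ) : signedPow q x * x = |x| ^ q := by
  rcases eq_or_ne x 0 with rfl | h
  · simp [Real.zero_rpow hq]
  · rw [signedPow, mul_assoc, ← abs_mul_abs_self x, ← mul_assoc,
      ← Real.rpow_add_one (abs_ne_zero.2 h), ← Real.rpow_add_one (abs_ne_zero.2 h)]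
    ring_nf

theorem signedPow_signedPow (hpq : p.HolderConjugate q) (x : ℝ) :
    signedPow p (signedPow q x) = x := by
  rcases eq_or_ne x 0 with rfl | h
  · simp [signedPow]
  · have hexp : (q - 1) * (p - 2) + (q - 2) = 0 := by linarith [hpq.mul_eq_add]
    rw [signedPow, abs_signedPow hpq.symm.lt, signedPow, ← Real.rpow_mul (abs_nonneg _),
      ← mul_assoc, ← Real.rpow_add (abs_pos.2 h), hexp, Real.rpow_zero, one_mul]

end SignedPow

/-! ### Eigenfunctions on `[0, 1]` -/

section HalfEigen

variable {p q α lam a : ℝ} {V w u r f f' : ℝ → ℝ}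

/-- The solution of `u' = r u` with `u 1 = 1`. -/
def expPrimitive (r : ℝ → ℝ) (x : ℝ) : ℝ := Real.exp (∫ t in (1 : ℝ)..x, r t)

theorem expPrimitive_pos (r : ℝ → ℝ) (x : ℝ) : 0 < expPrimitive r x := Real.exp_pos _

theorem continuousOn_expPrimitive (ha : a ≤ 1) (hr : ContinuousOn r (Icc a 1)) :
    ContinuousOn (expPrimitive r) (Icc a 1) := by
  have hint := (hr.intervalIntegrable_of_Icc (μ := volume) ha).symm
  have hprim :=
    (hint.absolutelyContinuousOnInterval_intervalIntegral (c := 1) (by simp)).continuousOn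
  rw [uIcc_of_ge ha] at hprim
  exact hprim.rexp

theorem hasDerivAt_expPrimitive {x : ℝ} (hr : ContinuousOn r (Ioc a 1)) (hx : x ∈ Ioo a 1) :
    HasDerivAt (expPrimitive r) (r x * expPrimitive r x) x := by
  have hint : IntervalIntegrable r volume 1 x := ((hr.mono fun y hy =>
    ⟨hx.1.trans_le hy.1, hy.2⟩).intervalIntegrable_of_Icc hx.2.le).symm
  have hr' := hr.mono Ioo_subset_Ioc_self
  rw [mul_comm]
  exact (intervalIntegral.integral_hasDerivAt_right hint
    (hr'.stronglyMeasurableAtFilter isOpen_Ioo x hx)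
    (hr'.continuousAt (Ioo_mem_nhds hx.1 hx.2))).exp

theorem continuousOn_Ioc_expPrimitive (hr : ContinuousOn r (Ioc a 1)) :
    ContinuousOn (expPrimitive r) (Ioc a 1) :=
  continuousOn_Ioc_of_forall_Icc fun _ hs => continuousOn_expPrimitive hs.2.le
    (hr.mono fun _ hx => ⟨hs.1.trans_le hx.1, hx.2⟩)

theorem exists_expPrimitive_le (ha : a < 1) (hr : ContinuousOn r (Ioc a 1))
    (hpos : ∀ᶠ x in 𝓝[>] a, 0 ≤ r x) : ∃ A, ∀ x ∈ Ioc a 1, expPrimitive r x ≤ A := by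
  obtain ⟨c, hac, hrc⟩ :=
    mem_nhdsGT_iff_exists_Ioc_subset.1 (hpos.and (Ioo_mem_nhdsGT ha))
  have hc1 : c ≤ 1 := (hrc ⟨hac, le_rfl⟩).2.2.le
  have hmono : MonotoneOn (expPrimitive r) (Ioc a c) := by
    refine monotoneOn_of_hasDerivWithinAt_nonneg (convex_Ioc a c)
      ((continuousOn_Ioc_expPrimitive hr).mono (Ioc_subset_Ioc_right hc1))
      (f' := fun x => r x * expPrimitive r x) ?_ ?_ <;> rw [interior_Ioc] <;> intro x hx
    · exact (hasDerivAt_expPrimitive hr ⟨hx.1, hx.2.trans_le hc1⟩).hasDerivWithinAt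
    · exact mul_nonneg (hrc (Ioo_subset_Ioc_self hx)).1 (expPrimitive_pos r x).le
  obtain ⟨A, hA⟩ := isCompact_Icc.exists_bound_of_continuousOn
    (continuousOn_expPrimitive hc1 (hr.mono fun _ hx => ⟨hac.trans_le hx.1, hx.2⟩))
  refine ⟨A, fun x hx => ?_⟩
  rcases le_total x c with hxc | hcx
  · exact (hmono ⟨hx.1, hxc⟩ ⟨hac, le_rfl⟩ hxc).trans ((le_abs_self _).trans (hA c ⟨le_rfl, hc1⟩))
  · exact (le_abs_self _).trans (hA x ⟨hcx, hx.2⟩)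

theorem abs_le_add_of_abs_deriv_le {b B : ℝ} (hf : ContinuousOn f (Ioc a b))
    (hf' : ∀ x ∈ Ioo a b, HasDerivAt f (f' x) x) (hB : ∀ x ∈ Ioo a b, |f' x| ≤ B) :
    ∀ x ∈ Ioc a b, |f x| ≤ |f b| + B * (b - x) := by
  intro x hx
  rcases hx.2.eq_or_lt with rfl | hxb
  · simp
  obtain ⟨t, ht, hslope⟩ := exists_hasDerivAt_eq_slope f f' hxb
    (hf.mono fun z hz => ⟨hx.1.trans_le hz.1, hz.2⟩) fun z hz => hf' z ⟨hx.1.trans hz.1, hz.2⟩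
  rw [eq_div_iff (sub_pos.2 hxb).ne'] at hslope
  have hdiff : |f b - f x| ≤ B * (b - x) := by
    rw [← hslope, abs_mul, abs_of_pos (sub_pos.2 hxb)]
    exact mul_le_mul_of_nonneg_right (hB t ⟨hx.1.trans ht.1, ht.2⟩) (sub_pos.2 hxb).le
  linarith [abs_sub_abs_le_abs_sub (f x) (f b), abs_sub_comm (f x) (f b)]

theorem tendsto_zero_of_mul_rpow_le {l : Filter ℝ} {s M : ℝ} (hs : 0 < s)
    (hw : Tendsto w l atTop) (hu : ∀ x, 0 ≤ u x) (h : ∀ᶠ x in l, w x * u x ^ s ≤ M) :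
    Tendsto u l (𝓝 0) := by
  have hbound : Tendsto (fun x => (M / w x) ^ s⁻¹) l (𝓝 0) := by
    simpa only [Real.zero_rpow (inv_pos.2 hs).ne'] using
      (hw.const_div_atTop M).rpow_const (p := s⁻¹) (Or.inr (inv_pos.2 hs).le)
  refine squeeze_zero' (Eventually.of_forall hu) ?_ hbound
  filter_upwards [h, hw.eventually_gt_atTop 0] with x hx hwx
  calc u x = (u x ^ s) ^ s⁻¹ := (Real.rpow_rpow_inv (hu x) hs.ne').symm
    _ ≤ (M / w x) ^ s⁻¹ := Real.rpow_le_rpow (Real.rpow_nonneg (hu x) _)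
      ((le_div_iff₀' hwx).2 hx) (inv_pos.2 hs).le

theorem continuousOn_update_left {b y : ℝ} (hf : ContinuousOn f (Ioc a b))
    (hlim : Tendsto f (𝓝[>] a) (𝓝 y)) : ContinuousOn (Function.update f a y) (Icc a b) := by
  rw [continuousOn_update_iff, Icc_sdiff_left]
  exact ⟨hf, fun _ => hlim.mono_left (nhdsWithin_mono _ Ioc_subset_Ioi_self)⟩

theorem hasDerivAt_flux (hpq : p.HolderConjugate q) {c : ℝ → ℝ} {x : ℝ}
    (hw : HasDerivAt w (c x - (p - 1) * |w x| ^ q) x) (hu : 0 < u x)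
    (hu' : HasDerivAt u (signedPow q (w x) * u x) x) :
    HasDerivAt (fun x => w x * u x ^ (p - 1)) (c x * u x ^ (p - 1)) x := by
  have hsplit : u x ^ (p - 1) = u x * u x ^ (p - 1 - 1) := by
    rw [Real.rpow_sub_one hu.ne' (p - 1), mul_div_cancel₀ _ hu.ne']
  convert! hw.mul (hu'.rpow_const (p := p - 1) (Or.inl hu.ne')) using 1
  rw [hsplit, ← signedPow_mul_self hpq.symm.ne_zero]
  ring

theorem intervalIntegrable_of_continuousOn_Ioc {b C : ℝ} (hab : a ≤ b)
    (hf : ContinuousOn f (Ioc a b)) (hC : ∀ x ∈ Ioc a b, |f x| ≤ C) :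
    IntervalIntegrable f volume a b := by
  rw [← uIoc_of_le hab] at hf hC
  exact (intervalIntegrable_const (c := C)).mono_fun' (hf.aestronglyMeasurable measurableSet_uIoc)
    ((ae_restrict_mem measurableSet_uIoc).mono hC)

/-- `u` is a positive solution on `(0, 1]` of the eigenvalue equation with the Robin condition at
`1` whose flux `|u'|^{p-2} u'` is `w u^{p-1}`. -/
structure HalfEigen (p q α : ℝ) (V : ℝ → ℝ) (lam : ℝ) (w u : ℝ → ℝ) : Prop where
  riccati : Riccati p q (fun x => V x - lam) w 0 1
  continuousOn : ContinuousOn w (Ioc 0 1)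
  apply_one : w 1 = -α
  continuousOn_fun : ContinuousOn u (Icc 0 1)
  pos : ∀ x ∈ Ioc (0 : ℝ) 1, 0 < u x
  hasDerivAt : ∀ x ∈ Ioo (0 : ℝ) 1, HasDerivAt u (signedPow q (w x) * u x) x
  flux_bounded : ∃ C, ∀ x ∈ Ioc (0 : ℝ) 1, |w x * u x ^ (p - 1)| ≤ C

theorem NeumannRiccati.exists_halfEigen (hpq : p.HolderConjugate q)
    (h : NeumannRiccati p q α V lam w) : ∃ u, HalfEigen p q α V lam w u ∧ 0 < u 0 := by
  have hr : ContinuousOn (fun x => signedPow q (w x)) (Icc 0 1) :=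
    (continuous_signedPow hpq.symm.lt).comp_continuousOn h.continuousOn
  set u := expPrimitive fun x => signedPow q (w x)
  have hpos : ∀ x, 0 < u x := expPrimitive_pos _
  have hu : ContinuousOn u (Icc 0 1) := continuousOn_expPrimitive zero_le_one hr
  obtain ⟨C, hC⟩ := isCompact_Icc.exists_bound_of_continuousOn
    (h.continuousOn.mul (hu.rpow_const (p := p - 1) fun x _ => Or.inl (hpos x).ne'))
  exact ⟨u, ⟨h.riccati, h.continuousOn.mono Ioc_subset_Icc_self, h.apply_one, hu,
    fun x _ => hpos x, fun x hx => hasDerivAt_expPrimitive (hr.mono Ioc_subset_Icc_self) hx,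
    C, fun x hx => hC x (Ioc_subset_Icc_self hx)⟩, hpos 0⟩

theorem exists_abs_flux_le (hpq : p.HolderConjugate q) (hV : ContinuousOn V (Icc 0 1)) {A : ℝ}
    (hw : Riccati p q (fun x => V x - lam) w 0 1) (hwc : ContinuousOn w (Ioc 0 1))
    (huc : ContinuousOn u (Ioc 0 1)) (hu : ∀ x ∈ Ioc (0 : ℝ) 1, 0 < u x)
    (hu' : ∀ x ∈ Ioo (0 : ℝ) 1, HasDerivAt u (signedPow q (w x) * u x) x)
    (hA : ∀ x ∈ Ioc (0 : ℝ) 1, u x ≤ A) :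
    ∃ C, ∀ x ∈ Ioc (0 : ℝ) 1, |w x * u x ^ (p - 1)| ≤ C := by
  have hp : 0 < p - 1 := sub_pos.2 hpq.lt
  have hA0 : 0 < A := (hu 1 (by simp)).trans_le (hA 1 (by simp))
  obtain ⟨B, hB⟩ := isCompact_Icc.exists_bound_of_continuousOn
    (hV.sub (continuousOn_const (c := lam)))
  have hB0 : 0 ≤ B := (norm_nonneg _).trans (hB 0 (by simp))
  have hderiv : ∀ x ∈ Ioo (0 : ℝ) 1, |(V x - lam) * u x ^ (p - 1)| ≤ B * A ^ (p - 1) := by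
    intro x hx
    have hx' := Ioo_subset_Ioc_self hx
    rw [abs_mul, abs_of_nonneg (Real.rpow_nonneg (hu x hx').le (p - 1))]
    exact mul_le_mul (hB x (Ioo_subset_Icc_self hx))
      (Real.rpow_le_rpow (hu x hx').le (hA x hx') hp.le) (Real.rpow_nonneg (hu x hx').le _) hB0
  refine ⟨|w 1 * u 1 ^ (p - 1)| + B * A ^ (p - 1), fun x hx => ?_⟩
  have hlen : B * A ^ (p - 1) * (1 - x) ≤ B * A ^ (p - 1) :=
    mul_le_of_le_one_right (by positivity) (by linarith [hx.1])
  refine (abs_le_add_of_abs_deriv_le (hwc.mul (huc.rpow_const fun y hy => Or.inl (hu y hy).ne'))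
    (fun y hy => hasDerivAt_flux hpq (c := fun x => V x - lam) (hw y hy)
      (hu y (Ioo_subset_Ioc_self hy)) (hu' y hy)) hderiv x hx).trans ?_
  simp only [Pi.mul_apply]
  linarith

theorem DirichletRiccati.exists_halfEigen (hpq : p.HolderConjugate q)
    (hV : ContinuousOn V (Icc 0 1)) (h : DirichletRiccati p q α V lam w) :
    ∃ v, HalfEigen p q α V lam w v ∧ v 0 = 0 := by
  have hr : ContinuousOn (fun x => signedPow q (w x)) (Ioc 0 1) :=
    (continuous_signedPow hpq.symm.lt).comp_continuousOn h.continuousOn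
  set u := expPrimitive fun x => signedPow q (w x)
  have hpos : ∀ x, 0 < u x := expPrimitive_pos _
  have huc : ContinuousOn u (Ioc 0 1) := continuousOn_Ioc_expPrimitive hr
  have hu' : ∀ x ∈ Ioo (0 : ℝ) 1, HasDerivAt u (signedPow q (w x) * u x) x :=
    fun x hx => hasDerivAt_expPrimitive hr hx
  obtain ⟨A, hA⟩ := exists_expPrimitive_le one_pos hr
    ((h.tendsto.eventually_ge_atTop 0).mono fun x hx =>
      (signedPow_of_nonneg hpq.symm.lt hx).ge.trans' (Real.rpow_nonneg hx _))
  obtain ⟨C, hC⟩ := exists_abs_flux_le hpq hV h.riccati h.continuousOn huc (fun x _ => hpos x)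
    hu' hA
  have hlim : Tendsto u (𝓝[>] 0) (𝓝 0) :=
    tendsto_zero_of_mul_rpow_le (sub_pos.2 hpq.lt) h.tendsto (fun x => (hpos x).le) <| by
      filter_upwards [Ioc_mem_nhdsGT one_pos] with x hx using (le_abs_self _).trans (hC x hx)
  have hupdate : ∀ x ∈ Ioc (0 : ℝ) 1, Function.update u 0 0 x = u x := fun x hx =>
    Function.update_of_ne hx.1.ne' _ _
  refine ⟨Function.update u 0 0, ⟨h.riccati, h.continuousOn, h.apply_one,
    continuousOn_update_left huc hlim, fun x hx => (hupdate x hx).symm ▸ hpos x, fun x hx => ?_,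
    C, fun x hx => (hupdate x hx).symm ▸ hC x hx⟩, Function.update_self ..⟩
  rw [hupdate x (Ioo_subset_Ioc_self hx)]
  refine (hu' x hx).congr_of_eventuallyEq ?_
  filter_upwards [Ioo_mem_nhds hx.1 hx.2] with z hz using hupdate z (Ioo_subset_Ioc_self hz)

end HalfEigen

namespace HalfEigen

variable {p q α lam : ℝ} {V w u η η' : ℝ → ℝ}

theorem signedPow_deriv (hpq : p.HolderConjugate q) (h : HalfEigen p q α V lam w u) {x : ℝ}
    (hx : x ∈ Ioc (0 : ℝ) 1) : signedPow p (signedPow q (w x) * u x) = w x * u x ^ (p - 1) := by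
  rw [signedPow_mul, signedPow_signedPow hpq, signedPow_of_pos (h.pos x hx)]

theorem continuousOn_deriv (hpq : p.HolderConjugate q) (h : HalfEigen p q α V lam w u) :
    ContinuousOn (fun x => signedPow q (w x) * u x) (Ioc 0 1) :=
  ((continuous_signedPow hpq.symm.lt).comp_continuousOn h.continuousOn).mul
    (h.continuousOn_fun.mono Ioc_subset_Icc_self)

theorem deriv_bounded (hpq : p.HolderConjugate q) (h : HalfEigen p q α V lam w u) :
    ∃ C, ∀ x ∈ Ioc (0 : ℝ) 1, |signedPow q (w x) * u x| ≤ C := by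
  have hp : 0 < p - 1 := sub_pos.2 hpq.lt
  obtain ⟨C, hC⟩ := h.flux_bounded
  refine ⟨C ^ (p - 1)⁻¹, fun x hx => ?_⟩
  rw [← Real.rpow_rpow_inv (abs_nonneg (signedPow q (w x) * u x)) hp.ne', ← abs_signedPow hpq.lt,
    h.signedPow_deriv hpq hx]
  exact Real.rpow_le_rpow (abs_nonneg _) (hC x hx) (inv_pos.2 hp).le

theorem sobolevOn (hpq : p.HolderConjugate q) (h : HalfEigen p q α V lam w u) :
    SobolevOn p 0 1 u fun x => signedPow q (w x) * u x := by
  obtain ⟨C, hC⟩ := h.deriv_bounded hpq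
  have hcont := h.continuousOn_deriv hpq
  have hint := intervalIntegrable_of_continuousOn_Ioc zero_le_one hcont hC
  refine ⟨hint, intervalIntegrable_of_continuousOn_Ioc zero_le_one (C := C ^ p)
    (hcont.abs.rpow_const fun x _ => Or.inr hpq.nonneg) fun x hx => ?_, fun x hx => ?_⟩
  · rw [abs_of_nonneg (by positivity)]
    exact Real.rpow_le_rpow (abs_nonneg _) (hC x hx) hpq.nonneg
  · rw [intervalIntegral.integral_eq_sub_of_hasDerivAt_of_le hx.1
      (h.continuousOn_fun.mono (Icc_subset_Icc_right hx.2))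
      (fun t ht => h.hasDerivAt t ⟨ht.1, ht.2.trans_le hx.2⟩) (hint.mono_set ?_)]
    · ring
    · rw [uIcc_of_le hx.1, uIcc_of_le zero_le_one]
      exact Icc_subset_Icc_right hx.2

theorem continuousOn_flux (h : HalfEigen p q α V lam w u) :
    ContinuousOn (fun x => w x * u x ^ (p - 1)) (Ioc 0 1) :=
  h.continuousOn.mul ((h.continuousOn_fun.mono Ioc_subset_Icc_self).rpow_const
    fun x hx => Or.inl (h.pos x hx).ne')

theorem intervalIntegrable_flux_mul (h : HalfEigen p q α V lam w u)
    (hη' : IntervalIntegrable η' volume 0 1) :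
    IntervalIntegrable (fun x => w x * u x ^ (p - 1) * η' x) volume 0 1 := by
  obtain ⟨C, hC⟩ := h.flux_bounded
  rw [intervalIntegrable_iff, uIoc_of_le zero_le_one] at hη' ⊢
  exact hη'.bdd_mul (h.continuousOn_flux.aestronglyMeasurable measurableSet_Ioc)
    ((ae_restrict_mem measurableSet_Ioc).mono hC)

theorem integral_flux (hpq : p.HolderConjugate q) (hV : ContinuousOn V (Icc 0 1))
    (h : HalfEigen p q α V lam w u) (hη : ContinuousOn η (Icc 0 1))
    (hη' : ∀ x ∈ Ioo (0 : ℝ) 1, HasDerivAt η (η' x) x) (hint : IntervalIntegrable η' volume 0 1)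
    (h0 : Tendsto (fun x => w x * u x ^ (p - 1) * η x) (𝓝[>] 0) (𝓝 0)) :
    ∫ x in (0 : ℝ)..1, (w x * u x ^ (p - 1) * η' x + (V x - lam) * u x ^ (p - 1) * η x) =
      -α * u 1 ^ (p - 1) * η 1 := by
  have hcont : ContinuousOn (fun x => (V x - lam) * u x ^ (p - 1) * η x) (Icc 0 1) :=
    ((hV.sub continuousOn_const).mul (h.continuousOn_fun.rpow_const
      fun _ _ => Or.inr (sub_pos.2 hpq.lt).le)).mul hη
  have hright := (h.continuousOn_flux.mul (hη.mono Ioc_subset_Icc_self)) 1 (by simp)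
  rw [intervalIntegral.integral_eq_sub_of_hasDerivAt_of_tendsto one_pos (fun x hx => ?_)
    ((h.intervalIntegrable_flux_mul hint).add (hcont.intervalIntegrable_of_Icc zero_le_one)) h0
    (hright.mono_left (nhdsWithin_Ioo_eq_nhdsLT (zero_lt_one' ℝ) ▸
      nhdsWithin_mono _ Ioo_subset_Ioc_self)), sub_zero, Pi.mul_apply, h.apply_one]
  convert! (hasDerivAt_flux hpq (c := fun x => V x - lam) (h.riccati x hx)
    (h.pos x (Ioo_subset_Ioc_self hx)) (h.hasDerivAt x hx)).mul (hη' x hx) using 1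
  ring

theorem halfEnergy_eq (hpq : p.HolderConjugate q) (hV : ContinuousOn V (Icc 0 1))
    (h : HalfEigen p q α V lam w u)
    (h0 : Tendsto (fun x => w x * u x ^ (p - 1) * u x) (𝓝[>] 0) (𝓝 0)) :
    halfEnergy p α V u (fun x => signedPow q (w x) * u x) = lam * halfMass p u := by
  have hs := h.sobolevOn hpq
  have hweak := h.integral_flux hpq hV h.continuousOn_fun h.hasDerivAt hs.intervalIntegrable h0
  have hintegrand : ∫ x in (0 : ℝ)..1, |signedPow q (w x) * u x| ^ p + (V x - lam) * |u x| ^ p =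
      ∫ x in (0 : ℝ)..1, (w x * u x ^ (p - 1) * (signedPow q (w x) * u x) +
        (V x - lam) * u x ^ (p - 1) * u x) := by
    refine intervalIntegral.integral_congr_ae (Eventually.of_forall fun x hx => ?_)
    rw [uIoc_of_le zero_le_one] at hx
    simp only [← signedPow_mul_self hpq.ne_zero]
    rw [h.signedPow_deriv hpq hx, signedPow_of_pos (h.pos x hx), mul_assoc (V x - lam)]
  have hone : |u 1| ^ p = u 1 ^ (p - 1) * u 1 := by
    rw [← signedPow_mul_self hpq.ne_zero, signedPow_of_pos (h.pos 1 (by simp))]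
  have hsub := hs.halfEnergy_sub_const (α := α) hpq.nonneg hV lam
  rw [halfEnergy, hintegrand, hweak, hone] at hsub
  linarith

theorem tendsto_flux_mul_of_apply_zero (h : HalfEigen p q α V lam w u)
    (hη : ContinuousOn η (Icc 0 1)) (hη0 : η 0 = 0) :
    Tendsto (fun x => w x * u x ^ (p - 1) * η x) (𝓝[>] 0) (𝓝 0) := by
  obtain ⟨C, hC⟩ := h.flux_bounded
  have hlim := tendsto_nhdsGT_of_continuousOn_Icc one_pos hη
  rw [hη0] at hlim
  refine bdd_le_mul_tendsto_zero' C ?_ hlim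
  filter_upwards [Ioc_mem_nhdsGT one_pos] with x hx using hC x hx

theorem tendsto_flux_mul_of_neumann (hpq : p.HolderConjugate q) (h : HalfEigen p q α V lam w u)
    (hw : NeumannRiccati p q α V lam w) (hη : ContinuousOn η (Icc 0 1)) :
    Tendsto (fun x => w x * u x ^ (p - 1) * η x) (𝓝[>] 0) (𝓝 0) := by
  have hflux := hw.continuousOn.mul (h.continuousOn_fun.rpow_const (p := p - 1)
    fun _ _ => Or.inr (sub_pos.2 hpq.lt).le)
  have hlim := tendsto_nhdsGT_of_continuousOn_Icc one_pos (hflux.mul hη)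
  simp only [Pi.mul_apply, hw.apply_zero, zero_mul] at hlim
  exact hlim

theorem halfMass_pos (hpq : p.HolderConjugate q) (h : HalfEigen p q α V lam w u) :
    0 < halfMass p u :=
  intervalIntegral.intervalIntegral_pos_of_pos_on
    ((continuousOn_abs_rpow hpq.nonneg h.continuousOn_fun).intervalIntegrable_of_Icc zero_le_one)
    (fun x hx => Real.rpow_pos_of_pos (abs_pos.2 (h.pos x (Ioo_subset_Ioc_self hx)).ne') _) one_pos

end HalfEigen

/-! ### Chebyshev's integral inequality -/

section Chebyshev

variable {a b : ℝ} {Q k ρ : ℝ → ℝ}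

theorem eqOn_zero_of_integral_eq_zero {f : ℝ → ℝ} (hab : a < b) (hf : ContinuousOn f (Icc a b))
    (hf0 : ∀ x ∈ Icc a b, 0 ≤ f x) (h : ∫ x in a..b, f x = 0) : ∀ x ∈ Icc a b, f x = 0 := by
  intro x hx
  by_contra hne
  exact (intervalIntegral.integral_pos hab hf (fun y hy => hf0 y (Ioc_subset_Icc_self hy))
    ⟨x, hx, (hf0 x hx).lt_of_ne' hne⟩).ne' h

theorem integral_bilinear_mul (hab : a ≤ b) (hQ : ContinuousOn Q (Icc a b))
    (hk : ContinuousOn k (Icc a b)) (hρ : ContinuousOn ρ (Icc a b)) (c₀ c₁ c₂ c₃ : ℝ) :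
    ∫ x in a..b, (c₀ + c₁ * Q x + c₂ * k x + c₃ * (Q x * k x)) * ρ x =
      c₀ * (∫ x in a..b, ρ x) + c₁ * (∫ x in a..b, Q x * ρ x) + c₂ * (∫ x in a..b, k x * ρ x) +
        c₃ * ∫ x in a..b, Q x * k x * ρ x := by
  have hint : ∀ {f : ℝ → ℝ} (c : ℝ), ContinuousOn f (Icc a b) →
      IntervalIntegrable (fun x => c * f x) volume a b := fun c hf =>
    (continuousOn_const.mul hf).intervalIntegrable_of_Icc hab
  have hQρ : IntervalIntegrable (fun x => c₁ * (Q x * ρ x)) volume a b := hint c₁ (hQ.mul hρ)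
  have hkρ : IntervalIntegrable (fun x => c₂ * (k x * ρ x)) volume a b := hint c₂ (hk.mul hρ)
  have hQkρ : IntervalIntegrable (fun x => c₃ * (Q x * k x * ρ x)) volume a b :=
    hint c₃ ((hQ.mul hk).mul hρ)
  simp only [← intervalIntegral.integral_const_mul]
  rw [← intervalIntegral.integral_add (hint c₀ hρ) hQρ,
    ← intervalIntegral.integral_add ((hint c₀ hρ).add hQρ) hkρ,
    ← intervalIntegral.integral_add (((hint c₀ hρ).add hQρ).add hkρ) hQkρ]
  congr! 2
  ring

theorem integral_sub_mul_sub_mul (hab : a ≤ b) (hQ : ContinuousOn Q (Icc a b))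
    (hk : ContinuousOn k (Icc a b)) (hρ : ContinuousOn ρ (Icc a b)) (t : ℝ) :
    ∫ x in a..b, (Q x - Q t) * (k x - k t) * ρ x =
      (∫ x in a..b, Q x * k x * ρ x) + -(∫ x in a..b, k x * ρ x) * Q t +
        -(∫ x in a..b, Q x * ρ x) * k t + (∫ x in a..b, ρ x) * (Q t * k t) := by
  have hexpand : ∀ x, (Q x - Q t) * (k x - k t) * ρ x =
      (Q t * k t + -k t * Q x + -Q t * k x + 1 * (Q x * k x)) * ρ x := fun x => by ring
  simp only [hexpand]
  rw [integral_bilinear_mul hab hQ hk hρ]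
  ring

theorem integral_integral_sub_mul_sub_mul (hab : a ≤ b) (hQ : ContinuousOn Q (Icc a b))
    (hk : ContinuousOn k (Icc a b)) (hρ : ContinuousOn ρ (Icc a b)) :
    ∫ t in a..b, (∫ x in a..b, (Q x - Q t) * (k x - k t) * ρ x) * ρ t =
      2 * ((∫ x in a..b, ρ x) * (∫ x in a..b, Q x * k x * ρ x) -
        (∫ x in a..b, Q x * ρ x) * ∫ x in a..b, k x * ρ x) := by
  simp only [integral_sub_mul_sub_mul hab hQ hk hρ]
  rw [integral_bilinear_mul hab hQ hk hρ]
  ring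

theorem sub_mul_sub_nonneg_of_monotoneOn {s : Set ℝ} (hQ : MonotoneOn Q s) (hk : MonotoneOn k s)
    {x t : ℝ} (hx : x ∈ s) (ht : t ∈ s) : 0 ≤ (Q x - Q t) * (k x - k t) := by
  rcases le_total x t with h | h
  · exact mul_nonneg_of_nonpos_of_nonpos (sub_nonpos.2 (hQ hx ht h)) (sub_nonpos.2 (hk hx ht h))
  · exact mul_nonneg (sub_nonneg.2 (hQ ht hx h)) (sub_nonneg.2 (hk ht hx h))

theorem integral_mul_integral_le_of_monotoneOn (hab : a ≤ b) (hQ : MonotoneOn Q (Icc a b))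
    (hQc : ContinuousOn Q (Icc a b)) (hk : MonotoneOn k (Icc a b)) (hkc : ContinuousOn k (Icc a b))
    (hρ : ∀ x ∈ Icc a b, 0 ≤ ρ x) (hρc : ContinuousOn ρ (Icc a b)) :
    (∫ x in a..b, Q x * ρ x) * (∫ x in a..b, k x * ρ x) ≤
      (∫ x in a..b, ρ x) * ∫ x in a..b, Q x * k x * ρ x := by
  have hnonneg : 0 ≤ ∫ t in a..b, (∫ x in a..b, (Q x - Q t) * (k x - k t) * ρ x) * ρ t :=
    intervalIntegral.integral_nonneg hab fun t ht => mul_nonneg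
      (intervalIntegral.integral_nonneg hab fun x hx =>
        mul_nonneg (sub_mul_sub_nonneg_of_monotoneOn hQ hk hx ht) (hρ x hx)) (hρ t ht)
  rw [integral_integral_sub_mul_sub_mul hab hQc hkc hρc] at hnonneg
  linarith

theorem eq_or_eq_of_integral_mul_integral_eq (hab : a < b) (hQ : MonotoneOn Q (Icc a b))
    (hQc : ContinuousOn Q (Icc a b)) (hk : MonotoneOn k (Icc a b)) (hkc : ContinuousOn k (Icc a b))
    (hρ : ∀ x ∈ Icc a b, 0 < ρ x) (hρc : ContinuousOn ρ (Icc a b))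
    (heq : (∫ x in a..b, Q x * ρ x) * (∫ x in a..b, k x * ρ x) =
      (∫ x in a..b, ρ x) * ∫ x in a..b, Q x * k x * ρ x) : Q a = Q b ∨ k a = k b := by
  have ha : a ∈ Icc a b := left_mem_Icc.2 hab.le
  have hb : b ∈ Icc a b := right_mem_Icc.2 hab.le
  have hint_nonneg : ∀ t ∈ Icc a b, ∀ x ∈ Icc a b, 0 ≤ (Q x - Q t) * (k x - k t) * ρ x :=
    fun t ht x hx => mul_nonneg (sub_mul_sub_nonneg_of_monotoneOn hQ hk hx ht) (hρ x hx).le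
  have houter : (∫ x in a..b, (Q x - Q b) * (k x - k b) * ρ x) * ρ b = 0 := by
    refine eqOn_zero_of_integral_eq_zero (a := a)
      (f := fun t => (∫ x in a..b, (Q x - Q t) * (k x - k t) * ρ x) * ρ t) hab ?_
      (fun t ht => mul_nonneg (intervalIntegral.integral_nonneg hab.le (hint_nonneg t ht))
        (hρ t ht).le) ?_ b hb
    · simp only [integral_sub_mul_sub_mul hab.le hQc hkc hρc]
      fun_prop
    · rw [integral_integral_sub_mul_sub_mul hab.le hQc hkc hρc, heq, sub_self, mul_zero]
  have hinner : (Q a - Q b) * (k a - k b) * ρ a = 0 :=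
    eqOn_zero_of_integral_eq_zero hab
      (((hQc.sub continuousOn_const).mul (hkc.sub continuousOn_const)).mul hρc)
      (hint_nonneg b hb) ((mul_eq_zero.1 houter).resolve_right (hρ b hb).ne') a ha
  simpa [(hρ a ha).ne', sub_eq_zero] using hinner

end Chebyshev

/-! ### Monotonicity of the gap on `[0, 1]` -/

section HalfGap

variable {p q α l₀ l₁ l₀' l₁' : ℝ} {V W Q u v w w' z z' : ℝ → ℝ}

theorem Riccati.le_of_right_Ioc {a b : ℝ} {c₁ c₂ w₁ w₂ : ℝ → ℝ} (hp : 1 < p) (hq : 1 < q)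
    (h₁ : Riccati p q c₁ w₁ a b) (h₂ : Riccati p q c₂ w₂ a b) (hw₁ : ContinuousOn w₁ (Ioc a b))
    (hw₂ : ContinuousOn w₂ (Ioc a b)) (hc : ∀ x ∈ Ioo a b, c₁ x ≤ c₂ x) (hb : w₂ b ≤ w₁ b) :
    ∀ x ∈ Ioc a b, w₂ x ≤ w₁ x := by
  intro x hx
  have hsub : Icc x b ⊆ Ioc a b := fun y hy => ⟨hx.1.trans_le hy.1, hy.2⟩
  exact (h₁.mono hx.1.le le_rfl).le_of_right hp hq (h₂.mono hx.1.le le_rfl) (hw₁.mono hsub)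
    (hw₂.mono hsub) (fun y hy => hc y ⟨hx.1.trans hy.1, hy.2⟩) hb x (left_mem_Icc.2 hx.2)

theorem NeumannRiccati.lt_dirichlet (hpq : p.HolderConjugate q)
    (hw : NeumannRiccati p q α V l₀ w) (hz : DirichletRiccati p q α V l₁ z) : l₀ < l₁ := by
  by_contra! hle
  have hzw : ∀ x ∈ Ioc (0 : ℝ) 1, z x ≤ w x :=
    hw.riccati.le_of_right_Ioc hpq.lt hpq.symm.lt hz.riccati
      (hw.continuousOn.mono Ioc_subset_Icc_self) hz.continuousOn (fun x _ => by linarith)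
      (hz.apply_one.trans hw.apply_one.symm).le
  refine not_tendsto_atTop_of_tendsto_nhds
    (tendsto_nhdsGT_of_continuousOn_Icc one_pos hw.continuousOn)
    (tendsto_atTop_mono' _ ?_ hz.tendsto)
  filter_upwards [Ioc_mem_nhdsGT one_pos] with x hx using hzw x hx

theorem NeumannRiccati.sub_mul_halfMass_le (hpq : p.HolderConjugate q)
    (hV : ContinuousOn V (Icc 0 1)) (hQ : ContinuousOn Q (Icc 0 1))
    (hw : NeumannRiccati p q α V l₀ w) (hu : HalfEigen p q α V l₀ w u)
    (hw' : NeumannRiccati p q α (fun x => V x + Q x) l₀' w') :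
    (l₀' - l₀) * halfMass p u ≤ ∫ x in (0 : ℝ)..1, Q x * |u x| ^ p := by
  have hus := hu.sobolevOn hpq
  have hle := hw'.mul_halfMass_le (V := fun x => V x + Q x) hpq (hV.add hQ) hus
  rw [hus.halfEnergy_add hpq.nonneg hV hQ,
    hu.halfEnergy_eq hpq hV (hu.tendsto_flux_mul_of_neumann hpq hw hu.continuousOn_fun)] at hle
  linarith

theorem DirichletRiccati.integral_le_sub_mul_halfMass (hpq : p.HolderConjugate q)
    (hV : ContinuousOn V (Icc 0 1)) (hQ : ContinuousOn Q (Icc 0 1))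
    (hz : DirichletRiccati p q α V l₁ z) (hv : HalfEigen p q α (fun x => V x + Q x) l₁' z' v)
    (hv0 : v 0 = 0) :
    ∫ x in (0 : ℝ)..1, Q x * |v x| ^ p ≤ (l₁' - l₁) * halfMass p v := by
  have hvs := hv.sobolevOn hpq
  have hle := hz.mul_halfMass_le v _ hvs hv0
  have heq := hv.halfEnergy_eq (V := fun x => V x + Q x) hpq (hV.add hQ)
    (hv.tendsto_flux_mul_of_apply_zero hv.continuousOn_fun hv0)
  rw [hvs.halfEnergy_add hpq.nonneg hV hQ] at heq
  linarith

theorem mul_halfMass_le_integral {m : ℝ} (hp : 0 ≤ p) (hQ : ContinuousOn Q (Icc 0 1))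
    (hu : ContinuousOn u (Icc 0 1)) (hm : ∀ x ∈ Icc (0 : ℝ) 1, m ≤ Q x) :
    m * halfMass p u ≤ ∫ x in (0 : ℝ)..1, Q x * |u x| ^ p := by
  rw [halfMass, ← intervalIntegral.integral_const_mul]
  have hup := continuousOn_abs_rpow hp hu
  refine intervalIntegral.integral_mono_on zero_le_one
    ((continuousOn_const.mul hup).intervalIntegrable_of_Icc zero_le_one)
    ((hQ.mul hup).intervalIntegrable_of_Icc zero_le_one) fun x hx => ?_
  gcongr
  exact hm x hx

theorem HalfEigen.monotoneOn_div (hq : 1 < q) (hu : HalfEigen p q α V l₀ w u)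
    (hv : HalfEigen p q α W l₁ z v) (hu0 : 0 < u 0) (hwz : ∀ x ∈ Ioo (0 : ℝ) 1, w x ≤ z x) :
    MonotoneOn (fun x => v x / u x) (Icc 0 1) := by
  have hpos : ∀ x ∈ Icc (0 : ℝ) 1, u x ≠ 0 := fun x hx =>
    hx.1.eq_or_lt.elim (fun h => h ▸ hu0.ne') fun h => (hu.pos x ⟨h, hx.2⟩).ne'
  refine monotoneOn_of_hasDerivWithinAt_nonneg (convex_Icc _ _)
    (f' := fun x => (signedPow q (z x) - signedPow q (w x)) * (v x / u x))
    (hv.continuousOn_fun.div hu.continuousOn_fun hpos) (fun x hx => ?_) fun x hx => ?_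
  all_goals rw [interior_Icc] at hx
  · have hux := hpos x (Ioo_subset_Icc_self hx)
    convert! ((hv.hasDerivAt x hx).div (hu.hasDerivAt x hx) hux).hasDerivWithinAt using 1
    field_simp
  · have hx' := Ioo_subset_Ioc_self hx
    exact mul_nonneg (sub_nonneg.2 (monotone_signedPow hq (hwz x hx)))
      (div_pos (hv.pos x hx') (hu.pos x hx')).le

theorem integral_mul_halfMass_le (hp : 0 < p) (hQ : MonotoneOn Q (Icc 0 1))
    (hQc : ContinuousOn Q (Icc 0 1)) (hu : ContinuousOn u (Icc 0 1)) (hv : ContinuousOn v (Icc 0 1))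
    (hu0 : ∀ x ∈ Icc (0 : ℝ) 1, 0 < u x) (hv0 : ∀ x ∈ Icc (0 : ℝ) 1, 0 ≤ v x)
    (hvu : MonotoneOn (fun x => v x / u x) (Icc 0 1)) :
    (∫ x in (0 : ℝ)..1, Q x * |u x| ^ p) * halfMass p v ≤
        halfMass p u * ∫ x in (0 : ℝ)..1, Q x * |v x| ^ p ∧
      ((∫ x in (0 : ℝ)..1, Q x * |u x| ^ p) * halfMass p v =
        halfMass p u * (∫ x in (0 : ℝ)..1, Q x * |v x| ^ p) →
          Q 0 = Q 1 ∨ v 0 / u 0 = v 1 / u 1) := by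
  have hquot : ∀ x ∈ Icc (0 : ℝ) 1, 0 ≤ v x / u x := fun x hx => div_nonneg (hv0 x hx) (hu0 x hx).le
  have hk : MonotoneOn (fun x => (v x / u x) ^ p) (Icc 0 1) := fun x hx y hy hxy =>
    Real.rpow_le_rpow (hquot x hx) (hvu hx hy hxy) hp.le
  have hkc : ContinuousOn (fun x => (v x / u x) ^ p) (Icc 0 1) :=
    (hv.div hu fun x hx => (hu0 x hx).ne').rpow_const fun _ _ => Or.inr hp.le
  have hρ : ∀ x ∈ Icc (0 : ℝ) 1, 0 < |u x| ^ p := fun x hx =>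
    Real.rpow_pos_of_pos (abs_pos.2 (hu0 x hx).ne') p
  have hρc := continuousOn_abs_rpow hp.le hu
  have hkρ : ∀ x ∈ Icc (0 : ℝ) 1, (v x / u x) ^ p * |u x| ^ p = |v x| ^ p := fun x hx => by
    rw [← Real.mul_rpow (hquot x hx) (abs_nonneg _), abs_of_pos (hu0 x hx),
      div_mul_cancel₀ _ (hu0 x hx).ne', abs_of_nonneg (hv0 x hx)]
  have hmass : ∫ x in (0 : ℝ)..1, (v x / u x) ^ p * |u x| ^ p = halfMass p v :=
    intervalIntegral.integral_congr (by rwa [uIcc_of_le zero_le_one])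
  have hint : ∫ x in (0 : ℝ)..1, Q x * (v x / u x) ^ p * |u x| ^ p =
      ∫ x in (0 : ℝ)..1, Q x * |v x| ^ p := by
    refine intervalIntegral.integral_congr fun x hx => ?_
    rw [uIcc_of_le zero_le_one] at hx
    simp only [mul_assoc, hkρ x hx]
  rw [← hmass, ← hint, halfMass]
  refine ⟨integral_mul_integral_le_of_monotoneOn zero_le_one hQ hQc hk hkc
    (fun x hx => (hρ x hx).le) hρc, fun heq => ?_⟩
  exact (eq_or_eq_of_integral_mul_integral_eq one_pos hQ hQc hk hkc hρ hρc heq).imp_right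
    (Real.rpow_left_injOn hp.ne' (hquot 0 (by simp)) (hquot 1 (by simp)))

/-- `g` is the difference between the first eigenvalues on `[0, 1]` with a Dirichlet and with a
Neumann condition at `0`; for a symmetric potential it is the fundamental gap on `(-1, 1)`. -/
def IsHalfGap (p q α : ℝ) (V : ℝ → ℝ) (g : ℝ) : Prop :=
  ∃ l₀ l₁ w z, NeumannRiccati p q α V l₀ w ∧ DirichletRiccati p q α V l₁ z ∧ g = l₁ - l₀

theorem exists_isHalfGap (hpq : p.HolderConjugate q) (α : ℝ) (hV : ContinuousOn V (Icc 0 1)) :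
    ∃ g, IsHalfGap p q α V g := by
  obtain ⟨l₀, w, hw⟩ := exists_neumannRiccati hpq α hV
  obtain ⟨l₁, z, hz⟩ := exists_dirichletRiccati hpq α hV
  exact ⟨_, l₀, l₁, w, z, hw, hz, rfl⟩

variable {g g' : ℝ}

theorem IsHalfGap.pos (hpq : p.HolderConjugate q) (h : IsHalfGap p q α V g) : 0 < g := by
  obtain ⟨l₀, l₁, w, z, hw, hz, rfl⟩ := h
  exact sub_pos.2 (hw.lt_dirichlet hpq hz)

theorem IsHalfGap.le_of_monotoneOn (hpq : p.HolderConjugate q) (hV : ContinuousOn V (Icc 0 1))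
    (hQc : ContinuousOn Q (Icc 0 1)) (hQ : MonotoneOn Q (Icc 0 1)) (h : IsHalfGap p q α V g)
    (h' : IsHalfGap p q α (fun x => V x + Q x) g') (hosc : Q 1 - Q 0 ≤ g) :
    g ≤ g' ∧ (g = g' → Q 0 = Q 1) := by
  obtain ⟨l₀, l₁, w, z, hw, hz, rfl⟩ := h
  obtain ⟨l₀', l₁', w', z', hw', hz', rfl⟩ := h'
  obtain ⟨u, hu, hu0⟩ := hw.exists_halfEigen hpq
  obtain ⟨v, hv, hv0⟩ := hz'.exists_halfEigen hpq (hV.add hQc)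
  have hMu := hu.halfMass_pos hpq
  have hMv := hv.halfMass_pos hpq
  have hupos : ∀ x ∈ Icc (0 : ℝ) 1, 0 < u x := fun x hx =>
    hx.1.eq_or_lt.elim (fun h => h ▸ hu0) fun h => hu.pos x ⟨h, hx.2⟩
  have hvnonneg : ∀ x ∈ Icc (0 : ℝ) 1, 0 ≤ v x := fun x hx =>
    hx.1.eq_or_lt.elim (fun h => h ▸ hv0.ge) fun h => (hv.pos x ⟨h, hx.2⟩).le
  have hlower := hw.sub_mul_halfMass_le hpq hV hQc hu hw'
  have hupper := hz.integral_le_sub_mul_halfMass hpq hV hQc hv hv0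
  have hQ0 : Q 0 ≤ l₁' - l₁ := le_of_mul_le_mul_right
    ((mul_halfMass_le_integral hpq.nonneg hQc hv.continuousOn_fun
      fun x hx => hQ (by simp) hx hx.1).trans hupper) hMv
  have hcoef : ∀ x ∈ Ioo (0 : ℝ) 1, V x + Q x - l₁' ≤ V x - l₀ := fun x hx => by
    linarith [hQ (Ioo_subset_Icc_self hx) (right_mem_Icc.2 zero_le_one) hx.2.le]
  have hwz : ∀ x ∈ Ioc (0 : ℝ) 1, w x ≤ z' x :=
    hz'.riccati.le_of_right_Ioc hpq.lt hpq.symm.lt hw.riccati hz'.continuousOn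
      (hw.continuousOn.mono Ioc_subset_Icc_self) hcoef (hw.apply_one.trans hz'.apply_one.symm).le
  obtain ⟨hcheb, hcheb_eq⟩ := integral_mul_halfMass_le hpq.pos hQ hQc hu.continuousOn_fun
    hv.continuousOn_fun hupos hvnonneg
    (hu.monotoneOn_div hpq.symm.lt hv hu0 fun x hx => hwz x (Ioo_subset_Ioc_self hx))
  have hchain := mul_le_mul_of_nonneg_right hlower hMv.le
  have hchain' := mul_le_mul_of_nonneg_left hupper hMu.le
  have hle : (l₀' - l₀) * (halfMass p u * halfMass p v) ≤
      (l₁' - l₁) * (halfMass p u * halfMass p v) := by linarith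
  refine ⟨by linarith [le_of_mul_le_mul_right hle (mul_pos hMu hMv)], fun heq => ?_⟩
  have hshift : l₀' - l₀ = l₁' - l₁ := by linarith
  rw [hshift] at hchain
  have hv1 : v 0 / u 0 ≠ v 1 / u 1 := by
    rw [hv0, zero_div]
    exact (div_pos (hv.pos 1 (by simp)) (hu.pos 1 (by simp))).ne
  exact (hcheb_eq (by linarith)).resolve_right hv1

theorem exists_final_step {g : ℝ → ℝ} {C : ℝ} (hC : 0 ≤ C) (h0 : 0 < g 0)
    (hstep : ∀ t s, 0 < s → s * C ≤ g t → g t ≤ g (t + s)) :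
    ∃ s, 0 < s ∧ s * C ≤ g (1 - s) ∧ g 0 ≤ g (1 - s) := by
  obtain ⟨n, hn⟩ := exists_nat_gt (C / g 0)
  have hn0 : (0 : ℝ) < n := (div_nonneg hC h0.le).trans_lt hn
  have hsmall : (n : ℝ)⁻¹ * C ≤ g 0 := by
    rw [inv_mul_le_iff₀ hn0]
    exact ((div_lt_iff₀ h0).1 hn).le
  have hle : ∀ k : ℕ, g 0 ≤ g (k * (n : ℝ)⁻¹) := by
    intro k
    induction k with
    | zero => simp
    | succ k ih =>
      have := hstep _ _ (inv_pos.2 hn0) (hsmall.trans ih)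
      rw [Nat.cast_succ, add_one_mul]
      exact ih.trans this
  have hlast : (((n - 1 : ℕ) : ℝ)) * (n : ℝ)⁻¹ = 1 - (n : ℝ)⁻¹ := by
    rw [Nat.cast_pred (Nat.cast_pos.1 hn0), sub_one_mul, mul_inv_cancel₀ hn0.ne']
  have hlast_le := hle (n - 1)
  rw [hlast] at hlast_le
  exact ⟨_, inv_pos.2 hn0, hsmall.trans hlast_le, hlast_le⟩

theorem exists_isHalfGap_le (hpq : p.HolderConjugate q) (α : ℝ) (hV : ContinuousOn V (Icc 0 1))
    (hW : ContinuousOn W (Icc 0 1)) (hVW : MonotoneOn (fun x => V x - W x) (Icc 0 1)) :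
    ∃ g g', IsHalfGap p q α W g ∧ IsHalfGap p q α V g' ∧ g ≤ g' ∧
      (g = g' → V 0 - W 0 = V 1 - W 1) := by
  have hpath : ∀ t : ℝ, ContinuousOn (fun x => W x + t * (V x - W x)) (Icc 0 1) := fun t =>
    hW.add (continuousOn_const.mul (hV.sub hW))
  choose g hg using fun t : ℝ => exists_isHalfGap hpq α (hpath t)
  have hstep : ∀ t s, 0 < s → s * ((V 1 - W 1) - (V 0 - W 0)) ≤ g t →
      g t ≤ g (t + s) ∧ (g t = g (t + s) → V 0 - W 0 = V 1 - W 1) := by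
    intro t s hs hosc
    have hts := hg (t + s)
    simp only [add_mul, ← add_assoc] at hts
    refine ((hg t).le_of_monotoneOn hpq (Q := fun x => s * (V x - W x)) (hpath t)
      (continuousOn_const.mul (hV.sub hW))
      (fun x hx y hy hxy => mul_le_mul_of_nonneg_left (hVW hx hy hxy) hs.le) hts
      (by simpa only [mul_sub] using hosc)).imp_right fun h heq => mul_left_cancel₀ hs.ne' (h heq)
  obtain ⟨s, hs, hosc, hle⟩ := exists_final_step
    (sub_nonneg.2 (hVW (by simp) (by simp) zero_le_one)) ((hg 0).pos hpq)
    fun t s hs hosc => (hstep t s hs hosc).1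
  obtain ⟨hlast, hlast_eq⟩ := hstep _ s hs hosc
  rw [sub_add_cancel] at hlast hlast_eq
  exact ⟨g 0, g 1, by simpa using hg 0, by simpa using hg 1, hle.trans hlast,
    fun heq => hlast_eq (by linarith)⟩

end HalfGap

/-! ### Weak derivatives on an interval -/

section WeakDerivative

variable {a b : ℝ} {g h φ F : ℝ → ℝ}

theorem exists_Icc_subset_Ioo_of_isCompact (hab : a < b) {K : Set ℝ} (hK : IsCompact K)
    (hsub : K ⊆ Ioo a b) : ∃ c d, a < c ∧ d < b ∧ K ⊆ Icc c d := by
  obtain ⟨m, hm⟩ := nonempty_Ioo.2 hab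
  have hK' := hK.insert m
  have hsub' : insert m K ⊆ Ioo a b := insert_subset hm hsub
  exact ⟨sInf (insert m K), sSup (insert m K), (hsub' (hK'.sInf_mem (insert_nonempty m K))).1,
    (hsub' (hK'.sSup_mem (insert_nonempty m K))).2,
    (subset_insert m K).trans (subset_Icc_csInf_csSup hK'.bddBelow hK'.bddAbove)⟩

theorem intervalIntegral_eq_zero_of_disjoint_tsupport {s t : ℝ}
    (hF : Disjoint (uIoc s t) (tsupport F)) : ∫ x in s..t, F x = 0 :=
  intervalIntegral.integral_zero_ae <| Eventually.of_forall fun _ hx =>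
    image_eq_zero_of_notMem_tsupport (disjoint_left.1 hF hx)

theorem exists_testFunction_deriv_eq (hab : a < b) (hF : ContDiff ℝ ∞ F) (hs : HasCompactSupport F)
    (ht : tsupport F ⊆ Ioo a b) (hint : ∫ x in a..b, F x = 0) :
    ∃ Φ : ℝ → ℝ, ContDiff ℝ ∞ Φ ∧ HasCompactSupport Φ ∧ tsupport Φ ⊆ Ioo a b ∧ deriv Φ = F := by
  obtain ⟨c, d, hac, hdb, hcd⟩ := exists_Icc_subset_Ioo_of_isCompact hab hs ht
  have hderiv : ∀ x, HasDerivAt (fun x => ∫ t in a..x, F t) (F x) x := fun x =>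
    (hF.continuous.integral_hasStrictDerivAt a x).hasDerivAt
  have hderiv_eq : deriv (fun x => ∫ t in a..x, F t) = F := funext fun x => (hderiv x).deriv
  have hzero : ∀ x, x ∉ Icc c d → ∫ t in a..x, F t = 0 := by
    intro x hx
    rcases not_and_or.1 hx with hxc | hxd
    · exact intervalIntegral_eq_zero_of_disjoint_tsupport <| disjoint_left.2 fun t htx htF =>
        (htx.2.trans_lt (max_lt hac (not_le.1 hxc))).not_ge (hcd htF).1
    · rw [← intervalIntegral.integral_add_adjacent_intervals (hF.continuous.intervalIntegrable a b)
        (hF.continuous.intervalIntegrable b x), hint, zero_add]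
      exact intervalIntegral_eq_zero_of_disjoint_tsupport <| disjoint_left.2 fun t htx htF =>
        ((lt_min hdb (not_le.1 hxd)).trans htx.1).not_ge (hcd htF).2
  refine ⟨_, contDiff_infty_iff_deriv.2 ⟨fun x => (hderiv x).differentiableAt, ?_⟩,
    .intro isCompact_Icc hzero, ?_, hderiv_eq⟩
  · rwa [hderiv_eq]
  · exact (closure_minimal (fun x hx => not_imp_comm.1 (hzero x) hx) isClosed_Icc).trans
      (Icc_subset_Ioo hac hdb)

theorem exists_testFunction_integral_eq_one (hab : a < b) :
    ∃ ρ : ℝ → ℝ, ContDiff ℝ ∞ ρ ∧ HasCompactSupport ρ ∧ tsupport ρ ⊆ Ioo a b ∧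
      ∫ x in a..b, ρ x = 1 := by
  let bump : ContDiffBump ((a + b) / 2) :=
    ⟨(b - a) / 8, (b - a) / 4, by linarith, by linarith⟩
  have hsub : tsupport (bump.normed volume) ⊆ Ioo a b := by
    rw [bump.tsupport_normed_eq, Real.closedBall_eq_Icc]
    exact Icc_subset_Ioo (by simp only [bump]; linarith) (by simp only [bump]; linarith)
  refine ⟨bump.normed volume, bump.contDiff_normed, bump.hasCompactSupport_normed, hsub, ?_⟩
  rw [intervalIntegral.integral_eq_integral_of_support_subset
    ((subset_tsupport _).trans (hsub.trans Ioo_subset_Ioc_self)), bump.integral_normed]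

theorem exists_integral_mul_eq_of_integral_mul_deriv_eq_zero (hab : a < b)
    (hh : ContinuousOn h (Icc a b))
    (H : ∀ φ : ℝ → ℝ, ContDiff ℝ ∞ φ → HasCompactSupport φ → tsupport φ ⊆ Ioo a b →
      ∫ x in a..b, h x * deriv φ x = 0) :
    ∃ c, ∀ φ : ℝ → ℝ, ContDiff ℝ ∞ φ → HasCompactSupport φ → tsupport φ ⊆ Ioo a b →
      ∫ x in a..b, h x * φ x = c * ∫ x in a..b, φ x := by
  obtain ⟨ρ, hρ, hρs, hρt, hρ1⟩ := exists_testFunction_integral_eq_one hab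
  refine ⟨∫ x in a..b, h x * ρ x, fun φ hφ hφs hφt => ?_⟩
  set m := ∫ x in a..b, φ x
  have hint : ∀ {ψ : ℝ → ℝ}, Continuous ψ → IntervalIntegrable (fun x => h x * ψ x) volume a b :=
    fun hψ => (hh.mul hψ.continuousOn).intervalIntegrable_of_Icc hab.le
  have hzero : ∫ x in a..b, φ x - m * ρ x = 0 := by
    rw [intervalIntegral.integral_sub (hφ.continuous.intervalIntegrable a b)
      ((hρ.continuous.intervalIntegrable a b).const_mul m),
      intervalIntegral.integral_const_mul, hρ1, mul_one, sub_self]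
  obtain ⟨Φ, hΦ, hΦs, hΦt, hderiv⟩ := exists_testFunction_deriv_eq hab
    (hφ.sub (contDiff_const.mul hρ)) (hφs.sub hρs.mul_left)
    ((tsupport_sub φ _).trans (union_subset hφt (tsupport_mul_subset_right.trans hρt))) hzero
  have hH := H Φ hΦ hΦs hΦt
  simp only [hderiv, mul_sub, mul_left_comm _ m] at hH
  rw [intervalIntegral.integral_sub (hint hφ.continuous) ((hint hρ.continuous).const_mul m),
    intervalIntegral.integral_const_mul, sub_eq_zero] at hH
  rw [hH, mul_comm]

theorem exists_eqOn_const_of_integral_mul_deriv_eq_zero (hab : a < b)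
    (hh : ContinuousOn h (Icc a b))
    (H : ∀ φ : ℝ → ℝ, ContDiff ℝ ∞ φ → HasCompactSupport φ → tsupport φ ⊆ Ioo a b →
      ∫ x in a..b, h x * deriv φ x = 0) :
    ∃ c, EqOn h (fun _ => c) (Icc a b) := by
  obtain ⟨c, hc⟩ := exists_integral_mul_eq_of_integral_mul_deriv_eq_zero hab hh H
  have hloc : LocallyIntegrableOn (fun x => h x - c) (Ioo a b) :=
    ((hh.sub continuousOn_const).mono Ioo_subset_Icc_self).locallyIntegrableOn measurableSet_Ioo
  have hae : ∀ᵐ x, x ∈ Ioo a b → h x - c = 0 := by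
    refine isOpen_Ioo.ae_eq_zero_of_integral_contDiff_smul_eq_zero hloc fun φ hφ hφs hφt => ?_
    have hsupp : Function.support (fun x => φ x • (h x - c)) ⊆ Ioc a b :=
      (Function.support_smul_subset_left φ _).trans
        ((subset_tsupport φ).trans (hφt.trans Ioo_subset_Ioc_self))
    rw [← intervalIntegral.integral_eq_integral_of_support_subset hsupp]
    simp only [smul_eq_mul, mul_comm (φ _), sub_mul]
    have hint : IntervalIntegrable (fun x => h x * φ x) volume a b :=
      (hh.mul hφ.continuous.continuousOn).intervalIntegrable_of_Icc hab.le
    rw [intervalIntegral.integral_sub hint ((hφ.continuous.intervalIntegrable a b).const_mul c),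
      intervalIntegral.integral_const_mul, hc φ hφ hφs hφt, sub_self]
  refine ⟨c, Measure.eqOn_Icc_of_ae_eq volume hab.ne ?_ hh continuousOn_const⟩
  rw [← Measure.restrict_congr_set Ioo_ae_eq_Icc, EventuallyEq,
    ae_restrict_iff' measurableSet_Ioo]
  simpa only [sub_eq_zero] using hae

theorem integral_primitive_mul_deriv {c : ℝ} (hab : a ≤ b) (hc : c ∈ Icc a b)
    (hg : IntervalIntegrable g volume a b) (hφ : ContDiff ℝ ∞ φ) (ht : tsupport φ ⊆ Ioo a b)
    (y : ℝ) :
    ∫ x in a..b, (y + ∫ t in c..x, g t) * deriv φ x = -∫ x in a..b, g x * φ x := by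
  rw [← uIcc_of_le hab] at hc
  have hprim : AbsolutelyContinuousOnInterval (fun x => y + ∫ t in c..x, g t) a b :=
    (LipschitzWith.const y).lipschitzOnWith.absolutelyContinuousOnInterval.add
      (hg.absolutelyContinuousOnInterval_intervalIntegral hc)
  have hφac : AbsolutelyContinuousOnInterval φ a b :=
    (hφ.of_le (by simp)).contDiffOn.absolutelyContinuousOnInterval
  have hφa : φ a = 0 := image_eq_zero_of_notMem_tsupport fun h => (ht h).1.false
  have hφb : φ b = 0 := image_eq_zero_of_notMem_tsupport fun h => (ht h).2.false
  rw [hprim.integral_mul_deriv_eq_deriv_mul hφac, hφa, hφb, mul_zero, mul_zero, sub_zero, zero_sub,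
    neg_inj]
  apply intervalIntegral.integral_congr_ae
  filter_upwards [hg.ae_hasDerivAt_integral] with x hx hxab
  rw [((hx (uIoc_subset_uIcc hxab) c hc).const_add y).deriv]

end WeakDerivative

/-! ### The Sobolev space on `(-1, 1)` -/

section SobolevSpace

theorem integral_volI (f : ℝ → ℝ) : ∫ x, f x ∂volI = ∫ x in (-1 : ℝ)..1, f x := by
  rw [intervalIntegral.integral_of_le (by norm_num), integral_Ioc_eq_integral_Ioo]

theorem intervalIntegrable_iff_volI {f : ℝ → ℝ} :
    IntervalIntegrable f volume (-1) 1 ↔ Integrable f volI :=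
  intervalIntegrable_iff_integrableOn_Ioo_of_le (by norm_num)

variable {p : ℝ} [hp : Fact (1 < p)]

theorem ofReal_exponent_ne_zero : ENNReal.ofReal p ≠ 0 :=
  (ENNReal.ofReal_pos.2 (zero_lt_one.trans hp.out)).ne'

theorem toReal_ofReal_exponent : (ENNReal.ofReal p).toReal = p :=
  ENNReal.toReal_ofReal (zero_le_one.trans hp.out.le)

theorem memLp_of_intervalIntegrable {g : ℝ → ℝ} (hg : IntervalIntegrable g volume (-1) 1)
    (hgp : IntervalIntegrable (fun x => |g x| ^ p) volume (-1) 1) :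
    MemLp g (ENNReal.ofReal p) volI := by
  rw [← integrable_norm_rpow_iff (intervalIntegrable_iff_volI.1 hg).aestronglyMeasurable
    ofReal_exponent_ne_zero ENNReal.ofReal_ne_top]
  simpa only [toReal_ofReal_exponent, Real.norm_eq_abs] using intervalIntegrable_iff_volI.1 hgp

variable (W W' : W1p p)

theorem intervalIntegrable_der : IntervalIntegrable (der W) volume (-1) 1 :=
  intervalIntegrable_iff_volI.2 ((Lp.memLp W.1.2).integrable Fact.out)

theorem intervalIntegrable_abs_der_rpow :
    IntervalIntegrable (fun x => |der W x| ^ p) volume (-1) 1 := by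
  have hint := (Lp.memLp W.1.2).integrable_norm_rpow ofReal_exponent_ne_zero ENNReal.ofReal_ne_top
  rw [toReal_ofReal_exponent] at hint
  exact intervalIntegrable_iff_volI.2 hint

theorem continuous_fn : Continuous (fn W) := W.1.1.continuous.Icc_extend'

theorem fn_apply {x : ℝ} (hx : x ∈ Icc (-1 : ℝ) 1) : fn W x = W.1.1 ⟨x, hx⟩ :=
  IccExtend_of_mem _ _ hx

theorem fn_add (x : ℝ) : fn (W + W') x = fn W x + fn W' x := rfl

theorem fn_smul (a x : ℝ) : fn (a • W) x = a * fn W x := rfl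

theorem fn_neg (x : ℝ) : fn (-W) x = -fn W x := rfl

theorem der_add : der (W + W') =ᵐ[volI] der W + der W' := Lp.coeFn_add W.1.2 W'.1.2

theorem der_smul (a : ℝ) : der (a • W) =ᵐ[volI] a • der W := Lp.coeFn_smul a W.1.2

variable {W W'}

theorem ne_zero_of_fn_ne_zero {x : ℝ} (h : fn W x ≠ 0) : W ≠ 0 := by
  rintro rfl
  exact h rfl

theorem continuous_fn_apply {x : ℝ} (hx : x ∈ Icc (-1 : ℝ) 1) :
    Continuous fun W : W1p p => fn W x := by
  simp only [fn_apply _ hx]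
  exact (ContinuousEvalConst.continuous_eval_const _).comp
    (continuous_fst.comp continuous_subtype_val)

variable (W)

theorem fn_eq_integral :
    ∀ x ∈ Icc (-1 : ℝ) 1, fn W x = fn W 0 + ∫ t in (0 : ℝ)..x, der W t := by
  have hle : (-1 : ℝ) < 1 := by norm_num
  have hder := intervalIntegrable_der W
  have hprim : ContinuousOn (fun x => ∫ t in (0 : ℝ)..x, der W t) (Icc (-1) 1) :=
    uIcc_of_le hle.le ▸ intervalIntegral.continuousOn_primitive_interval' hder (by simp)
  obtain ⟨c, hc⟩ := exists_eqOn_const_of_integral_mul_deriv_eq_zero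
    (h := fun x => fn W x - ∫ t in (0 : ℝ)..x, der W t) hle
    ((continuous_fn W).continuousOn.sub hprim) fun φ hφ hφs hφt => by
      have hweak : ∫ x in (-1 : ℝ)..1, fn W x * deriv φ x =
          -∫ x in (-1 : ℝ)..1, der W x * φ x := by
        rw [← integral_volI, ← integral_volI]
        exact W.2 φ hφ hφs hφt
      have hparts := integral_primitive_mul_deriv hle.le (c := 0) (by simp) hder hφ hφt 0
      have hφ' : Continuous (deriv φ) := hφ.continuous_deriv (by simp)
      simp only [zero_add] at hparts
      simp only [sub_mul]
      have hint : IntervalIntegrable (fun x => (∫ t in (0 : ℝ)..x, der W t) * deriv φ x) volume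
          (-1) 1 := (hprim.mul hφ'.continuousOn).intervalIntegrable_of_Icc hle.le
      have hint' : IntervalIntegrable (fun x => fn W x * deriv φ x) volume (-1) 1 :=
        ((continuous_fn W).mul hφ').intervalIntegrable _ _
      rw [intervalIntegral.integral_sub hint' hint, hweak, hparts, sub_self]
  intro x hx
  have h0 := hc (show (0 : ℝ) ∈ Icc (-1) 1 by simp)
  simp only [intervalIntegral.integral_same, sub_zero] at h0
  rw [h0, ← sub_eq_iff_eq_add]
  exact hc hx

variable {W}

theorem exists_W1p {g : ℝ → ℝ} (hg : MemLp g (ENNReal.ofReal p) volI) (y : ℝ) :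
    ∃ W : W1p p, (∀ x ∈ Icc (-1 : ℝ) 1, fn W x = y + ∫ t in (0 : ℝ)..x, g t) ∧
      der W =ᵐ[volI] g := by
  have hle : (-1 : ℝ) ≤ 1 := by norm_num
  have hgi := intervalIntegrable_iff_volI.2 (hg.integrable Fact.out)
  have hprim : ContinuousOn (fun x => y + ∫ t in (0 : ℝ)..x, g t) (Icc (-1) 1) :=
    continuousOn_const.add
      (uIcc_of_le hle ▸ intervalIntegral.continuousOn_primitive_interval' hgi (by simp))
  let u : C(Icc (-1 : ℝ) 1, ℝ) := ⟨fun x => y + ∫ t in (0 : ℝ)..x, g t, hprim.domRestrict⟩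
  have hu : ∀ x ∈ Icc (-1 : ℝ) 1, ext u x = y + ∫ t in (0 : ℝ)..x, g t :=
    fun x hx => IccExtend_of_mem _ _ hx
  refine ⟨⟨(u, hg.toLp g), fun φ hφ _ hφt => ?_⟩, hu, hg.coeFn_toLp⟩
  have hleft : ∫ x in (-1 : ℝ)..1, ext u x * deriv φ x =
      ∫ x in (-1 : ℝ)..1, (y + ∫ t in (0 : ℝ)..x, g t) * deriv φ x :=
    intervalIntegral.integral_congr fun x hx => by
      simp only [hu x (by rwa [uIcc_of_le hle] at hx)]
  have hright : ∫ x, (hg.toLp g) x * φ x ∂volI = ∫ x, g x * φ x ∂volI :=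
    integral_congr_ae (hg.coeFn_toLp.mul .rfl)
  rw [integral_volI, hleft, hright, integral_volI]
  exact integral_primitive_mul_deriv hle (by simp) hgi hφ hφt y

theorem eq_zero_of_fn_eq_zero (h : ∀ x ∈ Icc (-1 : ℝ) 1, fn W x = 0) : W = 0 := by
  have hder : der W =ᵐ[volI] 0 := by
    rw [EventuallyEq, ae_restrict_iff' measurableSet_Ioo]
    have hzero : ∀ x ∈ Icc (-1 : ℝ) 1, ∫ t in (0 : ℝ)..x, der W t = 0 := fun x hx => by
      simpa only [h x hx, h 0 (by simp), zero_add] using (fn_eq_integral W x hx).symm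
    filter_upwards [(intervalIntegrable_der W).ae_hasDerivAt_integral] with x hx hxI
    refine (hx (Icc_subset_uIcc (Ioo_subset_Icc_self hxI)) 0 (by simp)).unique ?_
    refine (hasDerivAt_const x (0 : ℝ)).congr_of_eventuallyEq ?_
    filter_upwards [Icc_mem_nhds hxI.1 hxI.2] using hzero
  refine Subtype.ext (Prod.ext (ContinuousMap.ext fun x => ?_) ?_)
  · rw [← fn_apply W x.2, h x x.2]
    rfl
  · exact Lp.ext (hder.trans (Lp.coeFn_zero ℝ (ENNReal.ofReal p) volI).symm)

end SobolevSpace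

/-! ### Splitting a Sobolev function into two halves -/

section Halves

theorem intervalIntegrable_neg_zero_of_comp_neg {F : ℝ → ℝ}
    (h : IntervalIntegrable (fun x => F (-x)) volume 0 1) : IntervalIntegrable F volume (-1) 0 := by
  simpa using ((IntervalIntegrable.iff_comp_neg (f := fun x => F (-x))).1 h).symm

theorem intervalIntegrable_comp_neg {F : ℝ → ℝ} (h : IntervalIntegrable F volume (-1) 1) :
    IntervalIntegrable (fun x => F (-x)) volume (-1) 1 := by
  simpa using ((IntervalIntegrable.iff_comp_neg (f := F)).1 h).symm

theorem integral_volI_eq_halves {F : ℝ → ℝ} (h₁ : IntervalIntegrable F volume 0 1)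
    (h₂ : IntervalIntegrable (fun x => F (-x)) volume 0 1) :
    ∫ x, F x ∂volI = (∫ x in (0 : ℝ)..1, F x) + ∫ x in (0 : ℝ)..1, F (-x) := by
  rw [integral_volI, ← intervalIntegral.integral_add_adjacent_intervals
    (intervalIntegrable_neg_zero_of_comp_neg h₂) h₁, intervalIntegral.integral_comp_neg, neg_zero,
    add_comm]

theorem integral_zero_neg (F : ℝ → ℝ) (x : ℝ) :
    ∫ t in (0 : ℝ)..(-x), F t = ∫ t in (0 : ℝ)..x, -F (-t) := by
  rw [intervalIntegral.integral_neg, intervalIntegral.integral_comp_neg, neg_zero,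
    ← intervalIntegral.integral_symm]

theorem intervalIntegrable_congr_Ioc {f g : ℝ → ℝ} (h : ∀ᵐ x : ℝ, x ∈ Ioc (0 : ℝ) 1 → f x = g x)
    (hg : IntervalIntegrable g volume 0 1) : IntervalIntegrable f volume 0 1 := by
  refine hg.congr_ae ?_
  rw [uIoc_of_le zero_le_one, EventuallyEq, ae_restrict_iff' measurableSet_Ioc]
  filter_upwards [h] with x hx hx'
  exact (hx hx').symm

theorem integral_volI_eq_of_halves {F F₁ F₂ : ℝ → ℝ} (h₁ : IntervalIntegrable F₁ volume 0 1)
    (h₂ : IntervalIntegrable F₂ volume 0 1) (e₁ : ∀ᵐ x : ℝ, x ∈ Ioc (0 : ℝ) 1 → F x = F₁ x)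
    (e₂ : ∀ᵐ x : ℝ, x ∈ Ioc (0 : ℝ) 1 → F (-x) = F₂ x) :
    ∫ x, F x ∂volI = (∫ x in (0 : ℝ)..1, F₁ x) + ∫ x in (0 : ℝ)..1, F₂ x := by
  rw [integral_volI_eq_halves (intervalIntegrable_congr_Ioc e₁ h₁)
    (intervalIntegrable_congr_Ioc e₂ h₂)]
  congr 1 <;> refine intervalIntegral.integral_congr_ae ?_ <;> rwa [uIoc_of_le zero_le_one]

theorem ae_Ioc_of_ae_volI {P : ℝ → Prop} (h : ∀ᵐ x ∂volI, P x) :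
    (∀ᵐ x : ℝ, x ∈ Ioc (0 : ℝ) 1 → P x) ∧ ∀ᵐ x : ℝ, x ∈ Ioc (0 : ℝ) 1 → P (-x) := by
  rw [ae_restrict_iff' measurableSet_Ioo] at h
  have hneg : ∀ᵐ x : ℝ, -x ∈ Ioo (-1 : ℝ) 1 → P (-x) :=
    (Measure.measurePreserving_neg (volume : Measure ℝ)).quasiMeasurePreserving.ae h
  have hne : ∀ᵐ x : ℝ, x ≠ 1 := Measure.ae_ne volume 1
  constructor
  · filter_upwards [h, hne] with x hx hx1 hm
    exact hx ⟨by linarith [hm.1], lt_of_le_of_ne hm.2 hx1⟩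
  · filter_upwards [hneg, hne] with x hx hx1 hm
    exact hx ⟨neg_lt_neg (lt_of_le_of_ne hm.2 hx1), by linarith [hm.1]⟩

theorem SobolevOn.const_mul {p a b : ℝ} {f g : ℝ → ℝ} (h : SobolevOn p a b f g) (c : ℝ) :
    SobolevOn p a b (fun x => c * f x) (fun x => c * g x) := by
  refine ⟨h.intervalIntegrable.const_mul c, ?_, fun x hx => ?_⟩
  · simp only [abs_mul, Real.mul_rpow (abs_nonneg _) (abs_nonneg _)]
    exact h.intervalIntegrable_rpow.const_mul _
  · rw [intervalIntegral.integral_const_mul, h.eq_integral x hx, mul_add]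

theorem SobolevOn.zero (p a b : ℝ) : SobolevOn p a b (fun _ => 0) fun _ => 0 :=
  ⟨by simp, by simp, by simp⟩

theorem halfEnergy_const_mul {p α c : ℝ} {V f g : ℝ → ℝ} :
    halfEnergy p α V (fun x => c * f x) (fun x => c * g x) = |c| ^ p * halfEnergy p α V f g := by
  simp only [halfEnergy, abs_mul, Real.mul_rpow (abs_nonneg c) (abs_nonneg _), mul_add,
    mul_left_comm _ (|c| ^ p), ← intervalIntegral.integral_const_mul]

theorem halfMass_const_mul {p c : ℝ} {f : ℝ → ℝ} :
    halfMass p (fun x => c * f x) = |c| ^ p * halfMass p f := by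
  simp only [halfMass, abs_mul, Real.mul_rpow (abs_nonneg c) (abs_nonneg _),
    intervalIntegral.integral_const_mul]

variable {p : ℝ} [hp : Fact (1 < p)]

/-- The Sobolev function `W` consists of the two halves `f₁ x = W x` and `f₂ x = W (-x)`, for
`x ∈ [0, 1]`, whose derivatives are `g₁` and `g₂`. -/
structure Halves (W : W1p p) (f₁ g₁ f₂ g₂ : ℝ → ℝ) : Prop where
  right : ∀ x ∈ Icc (0 : ℝ) 1, fn W x = f₁ x
  left : ∀ x ∈ Icc (0 : ℝ) 1, fn W (-x) = f₂ x
  der_right : ∀ᵐ x : ℝ, x ∈ Ioc (0 : ℝ) 1 → der W x = g₁ x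
  der_left : ∀ᵐ x : ℝ, x ∈ Ioc (0 : ℝ) 1 → der W (-x) = -g₂ x
  sobolevOn_right : SobolevOn p 0 1 f₁ g₁
  sobolevOn_left : SobolevOn p 0 1 f₂ g₂

theorem halves_self (W : W1p p) :
    Halves W (fn W) (der W) (fun x => fn W (-x)) (fun x => -der W (-x)) := by
  have hsub : uIcc (0 : ℝ) 1 ⊆ uIcc (-1) 1 := uIcc_subset_uIcc_right (by simp)
  have hder := intervalIntegrable_der W
  have hderp := intervalIntegrable_abs_der_rpow W
  refine ⟨fun _ _ => rfl, fun _ _ => rfl, by simp, by simp,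
    ⟨hder.mono_set hsub, hderp.mono_set hsub,
      fun x hx => fn_eq_integral W x (Icc_subset_Icc_left (by norm_num) hx)⟩,
    ⟨((intervalIntegrable_comp_neg hder).mono_set hsub).neg, ?_, fun x hx => ?_⟩⟩
  · simpa only [abs_neg] using (intervalIntegrable_comp_neg hderp).mono_set hsub
  · rw [fn_eq_integral W (-x) ⟨by linarith [hx.2], by linarith [hx.1]⟩, neg_zero,
      integral_zero_neg]

/-- The derivative of the function on `(-1, 1)` whose halves have derivatives `g₁` and `g₂`. -/
def glueDer (g₁ g₂ : ℝ → ℝ) (x : ℝ) : ℝ := if 0 < x then g₁ x else -g₂ (-x)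

theorem glueDer_of_pos {g₁ g₂ : ℝ → ℝ} {x : ℝ} (hx : 0 < x) : glueDer g₁ g₂ x = g₁ x :=
  if_pos hx

theorem glueDer_neg_of_pos {g₁ g₂ : ℝ → ℝ} {x : ℝ} (hx : 0 < x) :
    glueDer g₁ g₂ (-x) = -g₂ x := by
  rw [glueDer, if_neg (by linarith), neg_neg]

variable {W W' : W1p p} {f₁ g₁ f₂ g₂ V : ℝ → ℝ} {α lam : ℝ}

theorem memLp_glueDer (h₁ : SobolevOn p 0 1 f₁ g₁) (h₂ : SobolevOn p 0 1 f₂ g₂) :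
    MemLp (glueDer g₁ g₂) (ENNReal.ofReal p) volI := by
  have hglue : ∀ Φ : ℝ → ℝ, IntervalIntegrable (fun x => Φ (g₁ x)) volume 0 1 →
      IntervalIntegrable (fun x => Φ (-g₂ x)) volume 0 1 →
      IntervalIntegrable (fun x => Φ (glueDer g₁ g₂ x)) volume (-1) 1 := fun Φ i₁ i₂ =>
    (intervalIntegrable_neg_zero_of_comp_neg <| intervalIntegrable_congr_Ioc
      (Eventually.of_forall fun x hx => by rw [glueDer_neg_of_pos hx.1]) i₂).trans <|
    intervalIntegrable_congr_Ioc (Eventually.of_forall fun x hx => by rw [glueDer_of_pos hx.1]) i₁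
  refine memLp_of_intervalIntegrable
    (hglue (fun y => y) h₁.intervalIntegrable h₂.intervalIntegrable.neg)
    (hglue (fun y => |y| ^ p) h₁.intervalIntegrable_rpow ?_)
  simpa only [abs_neg] using h₂.intervalIntegrable_rpow

theorem exists_halves (h₁ : SobolevOn p 0 1 f₁ g₁) (h₂ : SobolevOn p 0 1 f₂ g₂)
    (h0 : f₁ 0 = f₂ 0) : ∃ W : W1p p, Halves W f₁ g₁ f₂ g₂ := by
  obtain ⟨W, hW, hder⟩ := exists_W1p (memLp_glueDer h₁ h₂) (f₁ 0)
  obtain ⟨hright, hleft⟩ := ae_Ioc_of_ae_volI hder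
  refine ⟨W, fun x hx => ?_, fun x hx => ?_, ?_, ?_, h₁, h₂⟩
  · rw [hW x (Icc_subset_Icc_left (by norm_num) hx), h₁.eq_integral x hx]
    congr 1
    refine intervalIntegral.integral_congr_ae (Eventually.of_forall fun t ht => ?_)
    rw [uIoc_of_le hx.1] at ht
    exact glueDer_of_pos ht.1
  · rw [hW (-x) ⟨by linarith [hx.2], by linarith [hx.1]⟩, h₂.eq_integral x hx, h0,
      integral_zero_neg]
    congr 1
    refine intervalIntegral.integral_congr_ae (Eventually.of_forall fun t ht => ?_)
    rw [uIoc_of_le hx.1] at ht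
    rw [glueDer_neg_of_pos ht.1, neg_neg]
  · filter_upwards [hright] with x hx hm
    rw [hx hm, glueDer_of_pos hm.1]
  · filter_upwards [hleft] with x hx hm
    rw [hx hm, glueDer_neg_of_pos hm.1]

theorem mass_pos (hW : W ≠ 0) : 0 < ∫ x, |fn W x| ^ p ∂volI := by
  obtain ⟨x, hx, hne⟩ : ∃ x ∈ Icc (-1 : ℝ) 1, fn W x ≠ 0 := by
    by_contra! hzero
    exact hW (eq_zero_of_fn_eq_zero hzero)
  rw [integral_volI]
  exact intervalIntegral.integral_pos (by norm_num)
    (continuousOn_abs_rpow (zero_le_one.trans hp.out.le) (continuous_fn W).continuousOn)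
    (fun y _ => by positivity) ⟨x, hx, by positivity⟩

namespace Halves

theorem smul (h : Halves W f₁ g₁ f₂ g₂) (a : ℝ) :
    Halves (a • W) (fun x => a * f₁ x) (fun x => a * g₁ x) (fun x => a * f₂ x)
      (fun x => a * g₂ x) := by
  obtain ⟨hright, hleft⟩ := ae_Ioc_of_ae_volI (der_smul W a)
  refine ⟨fun x hx => by rw [fn_smul, h.right x hx], fun x hx => by rw [fn_smul, h.left x hx],
    ?_, ?_, h.sobolevOn_right.const_mul a, h.sobolevOn_left.const_mul a⟩
  · filter_upwards [hright, h.der_right] with x hx hW hm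
    rw [hx hm, Pi.smul_apply, hW hm, smul_eq_mul]
  · filter_upwards [hleft, h.der_left] with x hx hW hm
    rw [hx hm, Pi.smul_apply, hW hm, smul_eq_mul, mul_neg]

theorem add (h : Halves W f₁ g₁ (fun _ => 0) fun _ => 0)
    (h' : Halves W' (fun _ => 0) (fun _ => 0) f₂ g₂) : Halves (W + W') f₁ g₁ f₂ g₂ := by
  obtain ⟨hright, hleft⟩ := ae_Ioc_of_ae_volI (der_add W W')
  refine ⟨fun x hx => by rw [fn_add, h.right x hx, h'.right x hx, add_zero],
    fun x hx => by rw [fn_add, h.left x hx, h'.left x hx, zero_add], ?_, ?_,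
    h.sobolevOn_right, h'.sobolevOn_left⟩
  · filter_upwards [hright, h.der_right, h'.der_right] with x hx hW hW' hm
    rw [hx hm, Pi.add_apply, hW hm, hW' hm, add_zero]
  · filter_upwards [hleft, h.der_left, h'.der_left] with x hx hW hW' hm
    rw [hx hm, Pi.add_apply, hW hm, hW' hm, neg_zero, zero_add]

theorem mass_eq (h : Halves W f₁ g₁ f₂ g₂) :
    ∫ x, |fn W x| ^ p ∂volI = halfMass p f₁ + halfMass p f₂ := by
  have hint : ∀ {f g : ℝ → ℝ}, SobolevOn p 0 1 f g →
      IntervalIntegrable (fun x => |f x| ^ p) volume 0 1 := fun hf =>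
    (continuousOn_abs_rpow (zero_le_one.trans hp.out.le)
      (hf.continuousOn zero_le_one)).intervalIntegrable_of_Icc zero_le_one
  exact integral_volI_eq_of_halves (hint h.sobolevOn_right) (hint h.sobolevOn_left)
    (Eventually.of_forall fun x hx => by rw [h.right x (Ioc_subset_Icc_self hx)])
    (Eventually.of_forall fun x hx => by rw [h.left x (Ioc_subset_Icc_self hx)])

theorem energy_eq (h : Halves W f₁ g₁ f₂ g₂) (hV : ContinuousOn V (Icc 0 1))
    (hsymm : IsSymmetric V) :
    (∫ x, |der W x| ^ p + V x * |fn W x| ^ p ∂volI) + α * (|fn W 1| ^ p + |fn W (-1)| ^ p) =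
      halfEnergy p α V f₁ g₁ + halfEnergy p α V f₂ g₂ := by
  have hint : ∀ {f g : ℝ → ℝ}, SobolevOn p 0 1 f g →
      IntervalIntegrable (fun x => |g x| ^ p + V x * |f x| ^ p) volume 0 1 := fun hf =>
    hf.intervalIntegrable_rpow.add
      (hf.intervalIntegrable_mul_rpow zero_le_one (zero_le_one.trans hp.out.le) hV)
  rw [integral_volI_eq_of_halves (hint h.sobolevOn_right) (hint h.sobolevOn_left), halfEnergy,
    halfEnergy, h.right 1 (by simp), h.left 1 (by simp)]
  · ring
  · filter_upwards [h.der_right] with x hx hm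
    rw [hx hm, h.right x (Ioc_subset_Icc_self hm)]
  · filter_upwards [h.der_left] with x hx hm
    rw [hx hm, h.left x (Ioc_subset_Icc_self hm), abs_neg,
      hsymm x ⟨by linarith [hm.1], hm.2⟩]

theorem le_rayleigh (h : Halves W f₁ g₁ f₂ g₂) (hV : ContinuousOn V (Icc 0 1))
    (hsymm : IsSymmetric V) (hW : W ≠ 0) (h₁ : lam * halfMass p f₁ ≤ halfEnergy p α V f₁ g₁)
    (h₂ : lam * halfMass p f₂ ≤ halfEnergy p α V f₂ g₂) : lam ≤ rayleigh p α V W := by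
  rw [rayleigh, le_div_iff₀ (mass_pos hW), h.energy_eq hV hsymm, h.mass_eq]
  linarith

theorem rayleigh_eq (h : Halves W f₁ g₁ f₂ g₂) (hV : ContinuousOn V (Icc 0 1))
    (hsymm : IsSymmetric V) (hW : W ≠ 0) (h₁ : halfEnergy p α V f₁ g₁ = lam * halfMass p f₁)
    (h₂ : halfEnergy p α V f₂ g₂ = lam * halfMass p f₂) : rayleigh p α V W = lam := by
  rw [rayleigh, div_eq_iff (mass_pos hW).ne', h.energy_eq hV hsymm, h.mass_eq]
  linarith

end Halves

end Halves

/-! ### Weak solutions -/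

namespace HalfEigen

variable {p q α lam s σ : ℝ} {V w u : ℝ → ℝ}

theorem weakForm_eq (hpq : p.HolderConjugate q) (h : HalfEigen p q α V lam w u) (hs : |s| = 1)
    (hσ : |σ| = 1) {x : ℝ} (hx : x ∈ Ioc (0 : ℝ) 1) (a b : ℝ) :
    signedPow p (σ * (signedPow q (w x) * u x)) * a + (V x - lam) * signedPow p (s * u x) * b =
      w x * u x ^ (p - 1) * (σ * a) + (V x - lam) * u x ^ (p - 1) * (s * b) := by
  rw [signedPow_mul_of_abs_eq_one hσ, signedPow_mul_of_abs_eq_one hs, h.signedPow_deriv hpq hx,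
    signedPow_of_pos (h.pos x hx)]
  ring

theorem intervalIntegrable_weakForm (hpq : p.HolderConjugate q) (hV : ContinuousOn V (Icc 0 1))
    (h : HalfEigen p q α V lam w u) {a b : ℝ → ℝ} (ha : Continuous a) (hb : Continuous b) :
    IntervalIntegrable
      (fun x => w x * u x ^ (p - 1) * a x + (V x - lam) * u x ^ (p - 1) * b x) volume 0 1 :=
  (h.intervalIntegrable_flux_mul (ha.intervalIntegrable 0 1)).add <|
    (((hV.sub continuousOn_const).mul (h.continuousOn_fun.rpow_const fun _ _ =>
      Or.inr hpq.sub_one_pos.le)).mul hb.continuousOn).intervalIntegrable_of_Icc zero_le_one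

theorem integral_weakForm_add_reflection (hpq : p.HolderConjugate q) (hV : ContinuousOn V (Icc 0 1))
    (h : HalfEigen p q α V lam w u) {ξ : ℝ → ℝ} (hξ : ContDiff ℝ 1 ξ)
    (h0 : Tendsto (fun x => w x * u x ^ (p - 1) * (ξ x + s * ξ (-x))) (𝓝[>] 0) (𝓝 0)) :
    (∫ x in (0 : ℝ)..1, w x * u x ^ (p - 1) * deriv ξ x + (V x - lam) * u x ^ (p - 1) * ξ x) +
      (∫ x in (0 : ℝ)..1, w x * u x ^ (p - 1) * (-s * deriv ξ (-x)) +
        (V x - lam) * u x ^ (p - 1) * (s * ξ (-x))) +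
      α * (u 1 ^ (p - 1) * (ξ 1 + s * ξ (-1))) = 0 := by
  have hξc := hξ.continuous
  have hξ'c : Continuous (deriv ξ) := hξ.continuous_deriv le_rfl
  have hξ' : ∀ x, HasDerivAt ξ (deriv ξ x) x := fun x =>
    (hξ.differentiable one_ne_zero x).hasDerivAt
  have hη' : ∀ x, HasDerivAt (fun x => ξ x + s * ξ (-x)) (deriv ξ x + -s * deriv ξ (-x)) x :=
    fun x => by
      convert! (hξ' x).add (((hξ' (-x)).comp x (hasDerivAt_neg x)).const_mul s) using 1
      ring
  have hflux := h.integral_flux hpq hV (by fun_prop) (fun x _ => hη' x)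
    (Continuous.intervalIntegrable (by fun_prop) 0 1) h0
  rw [← intervalIntegral.integral_add (h.intervalIntegrable_weakForm hpq hV hξ'c hξc)
    (h.intervalIntegrable_weakForm hpq hV (by fun_prop) (by fun_prop))]
  refine (congrArg (· + _) ((intervalIntegral.integral_congr fun x _ => ?_).trans hflux)).trans
    (by ring)
  ring

/-- The even (`s = 1`) or odd (`s = -1`) extension of an eigenfunction on `[0, 1]` solves the Robin
problem: testing it against `ξ` on `[-1, 1]` amounts to testing the half against `ξ x + s ξ(-x)`
on `[0, 1]`. -/
theorem isSolution [Fact (1 < p)] (hpq : p.HolderConjugate q) (hV : ContinuousOn V (Icc 0 1))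
    (hsymm : IsSymmetric V) (h : HalfEigen p q α V lam w u) (hs : |s| = 1) {W : W1p p}
    (hW : Halves W u (fun x => signedPow q (w x) * u x) (fun x => s * u x)
      fun x => s * (signedPow q (w x) * u x))
    (h0 : ∀ η : ℝ → ℝ, ContinuousOn η (Icc 0 1) → (s = -1 → η 0 = 0) →
      Tendsto (fun x => w x * u x ^ (p - 1) * η x) (𝓝[>] 0) (𝓝 0)) :
    IsSolution p α V lam W := by
  intro ξ hξ
  have hξc := hξ.continuous
  have hξ'c : Continuous (deriv ξ) := hξ.continuous_deriv le_rfl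
  have hflux := h.integral_weakForm_add_reflection hpq hV hξ
    (h0 (fun x => ξ x + s * ξ (-x)) (by fun_prop) fun hs => by simp [hs])
  change (∫ x, signedPow p (der W x) * deriv ξ x + (V x - lam) * signedPow p (fn W x) * ξ x ∂volI)
    + α * (signedPow p (fn W 1) * ξ 1 + signedPow p (fn W (-1)) * ξ (-1)) = 0
  rw [integral_volI_eq_of_halves (h.intervalIntegrable_weakForm hpq hV hξ'c hξc)
    (h.intervalIntegrable_weakForm hpq hV (a := fun x => -s * deriv ξ (-x))
      (b := fun x => s * ξ (-x)) (by fun_prop) (by fun_prop)),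
    hW.right 1 (by simp), hW.left 1 (by simp), signedPow_mul_of_abs_eq_one hs,
    signedPow_of_pos (h.pos 1 (by simp))]
  · linear_combination hflux
  · filter_upwards [hW.der_right] with x hx hm
    simpa only [one_mul, hx hm, hW.right x (Ioc_subset_Icc_self hm)] using
      h.weakForm_eq hpq abs_one abs_one hm (deriv ξ x) (ξ x)
  · filter_upwards [hW.der_left] with x hx hm
    rw [hx hm, hW.left x (Ioc_subset_Icc_self hm), hsymm x ⟨by linarith [hm.1], hm.2⟩,
      ← neg_mul]
    exact h.weakForm_eq hpq hs (by rwa [abs_neg]) hm (deriv ξ (-x)) (ξ (-x))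

end HalfEigen

/-! ### Krasnoselskii genus -/

section Genus

variable {E : Type*} [TopologicalSpace E]

theorem natCast_le_genus_iff [Neg E] {A : Set E} {n : ℕ} :
    (n : ℕ∞) ≤ genus A ↔ ∀ m < n, ¬HasOddMap A m := by
  simp only [genus, le_iInf_iff, Nat.cast_le]
  exact forall_congr' fun m => by rw [← not_lt, imp_not_comm]

theorem not_hasOddMap_zero_iff [Neg E] {A : Set E} : ¬HasOddMap A 0 ↔ A.Nonempty := by
  rw [nonempty_iff_ne_empty, not_iff_not]
  constructor
  · rintro ⟨h, -, -, hne⟩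
    exact eq_empty_of_forall_notMem fun x hx => hne x hx (Subsingleton.elim _ _)
  · rintro rfl
    exact ⟨0, continuousOn_empty _, by simp, by simp⟩

theorem hasOddMap_one_iff [Neg E] {A : Set E} :
    HasOddMap A 1 ↔ ∃ f : E → ℝ, ContinuousOn f A ∧ (∀ x ∈ A, f (-x) = -f x) ∧
      ∀ x ∈ A, f x ≠ 0 := by
  constructor
  · rintro ⟨h, hc, hodd, hne⟩
    exact ⟨fun x => h x 0, continuousOn_pi.1 hc 0, fun x hx => congrFun (hodd x hx) 0,
      fun x hx h0 => hne x hx (funext fun i => by rwa [Fin.fin_one_eq_zero i])⟩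
  · rintro ⟨f, hc, hodd, hne⟩
    exact ⟨fun x _ => f x, continuousOn_pi.2 fun _ => hc, fun x hx => funext fun _ => hodd x hx,
      fun x hx h => hne x hx (congrFun h 0)⟩

theorem one_le_genus_iff [Neg E] {A : Set E} : ((0 + 1 : ℕ) : ℕ∞) ≤ genus A ↔ A.Nonempty := by
  rw [natCast_le_genus_iff, ← not_hasOddMap_zero_iff]
  simp

theorem two_le_genus_iff [Neg E] {A : Set E} :
    ((1 + 1 : ℕ) : ℕ∞) ≤ genus A ↔ A.Nonempty ∧ ∀ f : E → ℝ, ContinuousOn f A →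
      (∀ x ∈ A, f (-x) = -f x) → ∃ x ∈ A, f x = 0 := by
  rw [natCast_le_genus_iff, ← not_hasOddMap_zero_iff]
  simp only [Nat.forall_lt_succ_right, hasOddMap_one_iff]
  simp

theorem exists_eq_zero_of_antiperiodic {f : ℝ → ℝ} {c : ℝ} (hf : Continuous f)
    (hodd : Function.Antiperiodic f c) : ∃ t, f t = 0 := by
  have hc : f c = -f 0 := by simpa using hodd 0
  rcases le_total 0 (f 0) with h0 | h0
  · exact mem_range_of_exists_le_of_exists_ge hf ⟨c, by linarith⟩ ⟨0, h0⟩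
  · exact mem_range_of_exists_le_of_exists_ge hf ⟨0, h0⟩ ⟨c, by linarith⟩

theorem two_le_genus_range [InvolutiveNeg E] {γ : ℝ → E} {c : ℝ} (hγ : Continuous γ)
    (hodd : Function.Antiperiodic γ c) : ((1 + 1 : ℕ) : ℕ∞) ≤ genus (range γ) := by
  refine two_le_genus_iff.2 ⟨range_nonempty γ, fun f hf hneg => ?_⟩
  obtain ⟨t, ht⟩ := exists_eq_zero_of_antiperiodic
    (hf.comp_continuous hγ mem_range_self)
    fun t => (congrArg f (hodd t)).trans (hneg _ (mem_range_self t))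
  exact ⟨γ t, mem_range_self t, ht⟩

end Genus

section Ellipse

variable {E : Type*} [AddCommGroup E] [Module ℝ E]

/-- The ellipse spanned by two vectors; the odd loops through which sets of genus two are built. -/
def ellipse (x y : E) (t : ℝ) : E := Real.cos t • x + Real.sin t • y

theorem antiperiodic_ellipse (x y : E) : Function.Antiperiodic (ellipse x y) Real.pi := fun t => by
  simp only [ellipse, Real.cos_add_pi, Real.sin_add_pi, neg_smul, neg_add]

theorem ellipse_ne_zero {x y : E} (h : LinearIndependent ℝ ![x, y]) (t : ℝ) :
    ellipse x y t ≠ 0 := fun h0 => by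
  obtain ⟨hcos, hsin⟩ := LinearIndependent.pair_iff.1 h _ _ h0
  simpa [hcos, hsin] using Real.sin_sq_add_cos_sq t

theorem continuous_ellipse [TopologicalSpace E] [ContinuousAdd E] [ContinuousSMul ℝ E] (x y : E) :
    Continuous (ellipse x y) :=
  (Real.continuous_cos.smul continuous_const).add (Real.continuous_sin.smul continuous_const)

end Ellipse

/-! ### The Ljusternik–Schnirelmann eigenvalues -/

section Minimax

variable {p q α lam : ℝ} {V w : ℝ → ℝ}

theorem halfEnergy_const_mul_eq {f g : ℝ → ℝ} (h : halfEnergy p α V f g = lam * halfMass p f)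
    (c : ℝ) : halfEnergy p α V (fun x => c * f x) (fun x => c * g x) =
      lam * halfMass p fun x => c * f x := by
  rw [halfEnergy_const_mul, halfMass_const_mul, h, mul_left_comm]

variable [hp : Fact (1 < p)]

theorem eigenvalue_eq_of_forall_exists_le {i : ℕ} {A : Set (W1p p)} (hA : A ∈ admissible p i)
    (hlam : ∀ W ∈ A, rayleigh p α V W = lam)
    (hle : ∀ B ∈ admissible p i, ∃ W ∈ B, lam ≤ rayleigh p α V W) :
    eigenvalue p α V i = lam := by
  obtain ⟨W, hW, -⟩ := hle A hA
  refine IsLeast.csInf_eq ⟨⟨A, hA, ⟨W, hW, hlam W hW⟩, ?_⟩, ?_⟩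
  · rintro _ ⟨W', hW', rfl⟩
    exact (hlam W' hW').le
  · rintro c ⟨B, hB, hc⟩
    obtain ⟨W', hW', hle'⟩ := hle B hB
    exact hle'.trans (hc.2 ⟨W', hW', rfl⟩)

theorem pair_mem_admissible {W : W1p p} (hW : W ≠ 0) : {W, -W} ∈ admissible p 0 := by
  refine ⟨(toFinite _).isCompact, ?_, ?_, one_le_genus_iff.2 ⟨W, by simp⟩⟩
  · rintro x (rfl | rfl) <;> simp
  · rintro (h | h)
    exacts [hW h.symm, neg_ne_zero.2 hW h.symm]

theorem range_ellipse_mem_admissible {W W' : W1p p} (h : LinearIndependent ℝ ![W, W']) :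
    range (ellipse W W') ∈ admissible p 1 := by
  have hodd := antiperiodic_ellipse W W'
  refine ⟨hodd.periodic_two_mul.compact_of_continuous Real.two_pi_pos.ne' (continuous_ellipse W W'),
    ?_, ?_, two_le_genus_range (continuous_ellipse W W') hodd⟩
  · rintro _ ⟨t, rfl⟩
    exact ⟨t + Real.pi, hodd t⟩
  · rintro ⟨t, ht⟩
    exact ellipse_ne_zero h t ht

namespace NeumannRiccati

theorem eigenvalue_zero_eq (hpq : p.HolderConjugate q) (hV : ContinuousOn V (Icc 0 1))
    (hsymm : IsSymmetric V) (h : NeumannRiccati p q α V lam w) : eigenvalue p α V 0 = lam := by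
  obtain ⟨u, hu, hu0⟩ := h.exists_halfEigen hpq
  have hE := hu.halfEnergy_eq hpq hV (hu.tendsto_flux_mul_of_neumann hpq h hu.continuousOn_fun)
  obtain ⟨W, hW⟩ := exists_halves (hu.sobolevOn hpq) (hu.sobolevOn hpq) rfl
  have hW0 : W ≠ 0 := ne_zero_of_fn_ne_zero (x := 0) (by rw [hW.right 0 (by simp)]; exact hu0.ne')
  refine eigenvalue_eq_of_forall_exists_le (pair_mem_admissible hW0) ?_ fun B hB => ?_
  · rintro _ (rfl | rfl)
    · exact hW.rayleigh_eq hV hsymm hW0 hE hE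
    · rw [← neg_one_smul ℝ W]
      exact (hW.smul (-1)).rayleigh_eq hV hsymm (by simpa using hW0)
        (halfEnergy_const_mul_eq hE _) (halfEnergy_const_mul_eq hE _)
  · obtain ⟨W', hW'⟩ := one_le_genus_iff.1 hB.2.2.2
    have hhalves := halves_self W'
    exact ⟨W', hW', hhalves.le_rayleigh hV hsymm (ne_of_mem_of_not_mem hW' hB.2.2.1)
      (h.mul_halfMass_le hpq hV hhalves.sobolevOn_right)
      (h.mul_halfMass_le hpq hV hhalves.sobolevOn_left)⟩

theorem isEigenvalue (hpq : p.HolderConjugate q) (hV : ContinuousOn V (Icc 0 1))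
    (hsymm : IsSymmetric V) (h : NeumannRiccati p q α V lam w) : IsEigenvalue p α V lam := by
  obtain ⟨u, hu, hu0⟩ := h.exists_halfEigen hpq
  obtain ⟨W, hW⟩ := exists_halves (hu.sobolevOn hpq) ((hu.sobolevOn hpq).const_mul 1) (by simp)
  exact ⟨W, ne_zero_of_fn_ne_zero (x := 0) (by rw [hW.right 0 (by simp)]; exact hu0.ne'),
    hu.isSolution hpq hV hsymm abs_one hW
      fun _ hη _ => hu.tendsto_flux_mul_of_neumann hpq h hη⟩

end NeumannRiccati

namespace DirichletRiccati

theorem eigenvalue_one_eq (hpq : p.HolderConjugate q) (hV : ContinuousOn V (Icc 0 1))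
    (hsymm : IsSymmetric V) (h : DirichletRiccati p q α V lam w) : eigenvalue p α V 1 = lam := by
  obtain ⟨v, hv, hv0⟩ := h.exists_halfEigen hpq hV
  have hv1 := (hv.pos 1 (by simp)).ne'
  have hE := hv.halfEnergy_eq hpq hV (hv.tendsto_flux_mul_of_apply_zero hv.continuousOn_fun hv0)
  obtain ⟨W, hW⟩ := exists_halves (hv.sobolevOn hpq) (.zero p 0 1) hv0
  obtain ⟨W', hW'⟩ := exists_halves (.zero p 0 1) (hv.sobolevOn hpq) hv0.symm
  have hhalves : ∀ a b : ℝ, Halves (a • W + b • W') (fun x => a * v x)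
      (fun x => a * (signedPow q (w x) * v x)) (fun x => b * v x)
      (fun x => b * (signedPow q (w x) * v x)) := fun a b =>
    Halves.add (by simpa only [mul_zero] using hW.smul a)
      (by simpa only [mul_zero] using hW'.smul b)
  have hind : LinearIndependent ℝ ![W, W'] := LinearIndependent.pair_iff.2 fun a b hab => by
    have hr := (hhalves a b).right 1 (by simp)
    have hl := (hhalves a b).left 1 (by simp)
    rw [hab] at hr hl
    exact ⟨(mul_eq_zero.1 hr.symm).resolve_right hv1, (mul_eq_zero.1 hl.symm).resolve_right hv1⟩
  refine eigenvalue_eq_of_forall_exists_le (range_ellipse_mem_admissible hind) ?_ fun B hB => ?_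
  · rintro _ ⟨t, rfl⟩
    exact (hhalves _ _).rayleigh_eq hV hsymm (ellipse_ne_zero hind t)
      (halfEnergy_const_mul_eq hE _) (halfEnergy_const_mul_eq hE _)
  · obtain ⟨W₀, hW₀, hzero⟩ := (two_le_genus_iff.1 hB.2.2.2).2 _
      (continuous_fn_apply (x := 0) (by simp)).continuousOn fun W _ => fn_neg W 0
    have hself := halves_self W₀
    exact ⟨W₀, hW₀, hself.le_rayleigh hV hsymm (ne_of_mem_of_not_mem hW₀ hB.2.2.1)
      (h.mul_halfMass_le _ _ hself.sobolevOn_right hzero)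
      (h.mul_halfMass_le _ _ hself.sobolevOn_left (by simpa using hzero))⟩

theorem isEigenvalue (hpq : p.HolderConjugate q) (hV : ContinuousOn V (Icc 0 1))
    (hsymm : IsSymmetric V) (h : DirichletRiccati p q α V lam w) : IsEigenvalue p α V lam := by
  obtain ⟨v, hv, hv0⟩ := h.exists_halfEigen hpq hV
  obtain ⟨W, hW⟩ := exists_halves (hv.sobolevOn hpq) ((hv.sobolevOn hpq).const_mul (-1))
    (by simp [hv0])
  exact ⟨W, ne_zero_of_fn_ne_zero (x := 1)
      (by rw [hW.right 1 (by simp)]; exact (hv.pos 1 (by simp)).ne'),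
    hv.isSolution hpq hV hsymm (by simp) hW
      fun _ hη hη0 => hv.tendsto_flux_mul_of_apply_zero hη (hη0 rfl)⟩

end DirichletRiccati

theorem IsHalfGap.gap_eq {g : ℝ} (hpq : p.HolderConjugate q) (hV : ContinuousOn V (Icc 0 1))
    (hsymm : IsSymmetric V) (h : IsHalfGap p q α V g) : gap p α V = g := by
  obtain ⟨l₀, l₁, w, z, hw, hz, rfl⟩ := h
  rw [gap, hz.eigenvalue_one_eq hpq hV hsymm, hw.eigenvalue_zero_eq hpq hV hsymm]

theorem isEigenvalue_eigenvalue_zero (α : ℝ) (hV : ContinuousOn V (Icc 0 1))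
    (hsymm : IsSymmetric V) : IsEigenvalue p α V (eigenvalue p α V 0) := by
  have hpq := Real.HolderConjugate.conjExponent hp.out
  obtain ⟨l₀, w, hw⟩ := exists_neumannRiccati hpq α hV
  rw [hw.eigenvalue_zero_eq hpq hV hsymm]
  exact hw.isEigenvalue hpq hV hsymm

theorem isEigenvalue_eigenvalue_one (α : ℝ) (hV : ContinuousOn V (Icc 0 1))
    (hsymm : IsSymmetric V) : IsEigenvalue p α V (eigenvalue p α V 1) := by
  have hpq := Real.HolderConjugate.conjExponent hp.out
  obtain ⟨l₁, z, hz⟩ := exists_dirichletRiccati hpq α hV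
  rw [hz.eigenvalue_one_eq hpq hV hsymm]
  exact hz.isEigenvalue hpq hV hsymm

end Minimax

/-! ### Symmetric single-well potentials -/

section SingleWell

variable {f V : ℝ → ℝ} {a b : ℝ}

theorem monotoneOn_Icc_of_monotoneOn_Ioo (hab : a < b) (hf : ContinuousOn f (Icc a b))
    (hmono : MonotoneOn f (Ioo a b)) : MonotoneOn f (Icc a b) := by
  have hcluster : ∀ x ∈ Icc a b, ClusterPt x (𝓟 (Ioo a b)) := fun x hx => by
    rwa [← mem_closure_iff_clusterPt, closure_Ioo hab.ne]
  have ha := left_mem_Icc.2 hab.le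
  have hb := right_mem_Icc.2 hab.le
  have hleft := hmono.insert_of_continuousWithinAt (hcluster a ha)
    ((hf a ha).mono Ioo_subset_Icc_self)
  rw [Ioo_insert_left hab] at hleft
  have hright := hleft.insert_of_continuousWithinAt
    ((hcluster b hb).mono (principal_mono.2 Ioo_subset_Ico_self))
    ((hf b hb).mono Ico_subset_Icc_self)
  rwa [Ico_insert_right hab.le] at hright

theorem IsSymmetric.monotoneOn_of_isSingleWell (hsymm : IsSymmetric V) (hwell : IsSingleWell V)
    (hV : ContinuousOn V (Icc 0 1)) : MonotoneOn V (Icc 0 1) := by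
  obtain ⟨x₀, -, hanti, hmono⟩ := hwell
  refine monotoneOn_Icc_of_monotoneOn_Ioo one_pos hV ?_
  rcases le_total x₀ 0 with h | h
  · exact hmono.mono (Ioo_subset_Ioo_left h)
  · intro x hx y hy hxy
    rw [← hsymm x ⟨by linarith [hx.1], hx.2.le⟩, ← hsymm y ⟨by linarith [hy.1], hy.2.le⟩]
    exact hanti ⟨by linarith [hy.2], by linarith [hy.1]⟩ ⟨by linarith [hx.2], by linarith [hx.1]⟩
      (neg_le_neg hxy)

theorem IsSymmetric.eq_of_monotoneOn (hsymm : IsSymmetric V) (hmono : MonotoneOn V (Icc 0 1))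
    (h01 : V 0 = V 1) : ∀ x ∈ Icc (-1 : ℝ) 1, V x = V 0 := by
  have hright : ∀ x ∈ Icc (0 : ℝ) 1, V x = V 0 := fun x hx =>
    le_antisymm (h01 ▸ hmono hx (by simp) hx.2) (hmono (by simp) hx hx.1)
  intro x hx
  rcases le_total 0 x with h0 | h0
  · exact hright x ⟨h0, hx.2⟩
  · rw [← hsymm x hx]
    exact hright (-x) ⟨by linarith, by linarith [hx.1]⟩

theorem IsSymmetric.sub {W : ℝ → ℝ} (hV : IsSymmetric V) (hW : IsSymmetric W) :
    IsSymmetric fun x => V x - W x := fun x hx => by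
  simp only [hV x hx, hW x hx]

end SingleWell

end RobinGap

end

theorem theorem1_general {p : ℝ} [Fact (1 < p)] (α : ℝ) {V W : ℝ → ℝ}
    (hV : ContinuousOn V (Set.Icc (-1) 1)) (hVsymm : RobinGap.IsSymmetric V)
    (hW : ContinuousOn W (Set.Icc (-1) 1)) (hWsymm : RobinGap.IsSymmetric W)
    (hwell : RobinGap.IsSingleWell fun x => V x - W x) :
    RobinGap.IsEigenvalue p α V (RobinGap.eigenvalue p α V 0) ∧
    RobinGap.IsEigenvalue p α V (RobinGap.eigenvalue p α V 1) ∧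
    RobinGap.gap p α W ≤ RobinGap.gap p α V ∧
    (RobinGap.gap p α V = RobinGap.gap p α W →
      ∃ c : ℝ, ∀ x ∈ Set.Icc (-1 : ℝ) 1, V x - W x = c) := by
  have hpq := Real.HolderConjugate.conjExponent (Fact.out : 1 < p)
  have hsub : Set.Icc (0 : ℝ) 1 ⊆ Set.Icc (-1) 1 := Set.Icc_subset_Icc_left (by norm_num)
  have hsymm := hVsymm.sub hWsymm
  have hmono := hsymm.monotoneOn_of_isSingleWell hwell ((hV.sub hW).mono hsub)
  obtain ⟨g, g', hg, hg', hle, heq⟩ :=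
    RobinGap.exists_isHalfGap_le hpq α (hV.mono hsub) (hW.mono hsub) hmono
  rw [hg.gap_eq hpq (hW.mono hsub) hWsymm, hg'.gap_eq hpq (hV.mono hsub) hVsymm]
  exact ⟨RobinGap.isEigenvalue_eigenvalue_zero α (hV.mono hsub) hVsymm,
    RobinGap.isEigenvalue_eigenvalue_one α (hV.mono hsub) hVsymm, hle,
    fun h => ⟨_, hsymm.eq_of_monotoneOn hmono (heq h.symm)⟩⟩

theorem theorem1 (p : ℝ) [Fact (1 < p)] (α : ℝ) (V : ℝ → ℝ)
    (hV : ContinuousOn V (Set.Icc (-1) 1))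
    (hsymm : RobinGap.IsSymmetric V) (hwell : RobinGap.IsSingleWell V) :
    RobinGap.IsEigenvalue p α V (RobinGap.eigenvalue p α V 0) ∧
    RobinGap.IsEigenvalue p α V (RobinGap.eigenvalue p α V 1) ∧
    RobinGap.gap p α (fun _ => 0) ≤ RobinGap.gap p α V ∧
    (RobinGap.gap p α V = RobinGap.gap p α (fun _ => 0) →
      ∃ c : ℝ, ∀ x ∈ Set.Icc (-1 : ℝ) 1, V x = c) := by
  simpa only [sub_zero] using theorem1_general α hV hsymm continuousOn_const (W := fun _ => 0)
    (fun _ _ => rfl) (by simpa only [sub_zero] using hwell)
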